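/- **Setting.** Let $d\ge 1$, let $m_d$ be Lebesgue measure on $\mathbb{R}^d$, and let $\widehat f(\xi)=\int_{\mathbb{R}^d} f(t)e^{-2\pi i\xi\cdot t}\,dm_d(t)$ denote the Fourier transform, extended to $L^2(\mathbb{R}^d)$. All cubes have sides parallel to the coordinate axes. *Weights.* Let $W:[0,\infty)\to[0,\infty]$ be non-decreasing and lower semicontinuous with $W\equiv 1$ on $[0,1]$ and $\lim_{t\to\infty}W(t)=\infty$, such that $\log r\mapsto \log W(r)$ is convex on $r\in[1,\infty)$, and $$\int_0^\infty \frac{\log W(t)}{1+t^2}\,dm_1(t)=\infty .$$ For $n\ge 0$ put $M_n=\sup_{t\ge 0} t^n/W(t)$, and for $A>1$ let $\mathcal{M}_A=\{\widetilde M_n\}_{n\ge 0}$ with $\widetilde M_0=1$ and $\widetilde M_n=A^n M_{n+d}/M_d$ for $n\ge 1$. *The constant $\Theta$.* For a sequence $\mathcal{M}=\{m_n\}_{n\geq 0}$ in $[0,\infty]$ and a closed cube $Q\subset\mathbb{R}^d$, let $C_{\mathcal{M}}(Q)$ be the class of smooth functions $g:Q\to\mathbb{R}$ with $|D^\alpha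 g|\le m_{|\alpha|}$ on $Q$ for every multi-index $\alpha$. For $t,s>0$ let $\Theta_{\mathcal{M}}(d,t,s)\in[0,\infty]$ be the least constant $\Theta$ such that $$\|g\|_{L^\infty(Q)}\le \Theta\,\|g\|_{L^\infty(E)}$$ for every closed cube $Q\subset\mathbb{R}^d$ of side-length $1$, every $g\in C_{\mathcal{M}}(Q)$ with $\|g\|_{L^\infty(Q)}\ge t$, and every Borel set $E\subset Q$ with $m_d(E)\ge s$ ($\Theta_{\mathcal{M}}(d,t,s)=\infty$ if there is no finite such constant). *Relative density.* A Borel set $E\subset\mathbb{R}^d$ is $(\gamma,1)$-relatively dense if $m_d(E\cap Q)\ge\gamma$ for every cube $Q$ of side-length $1$. **Proposition 3.1.** For every $d\ge 1$ there exists $A=A(d)>1$, depending only on $d$, such that for every weight $W$ as above, every $C_W>0$ and every $\gamma\in(0,1)$, one has $$\Theta_{\mathcal{M}_A}\Bigl(d,\tfrac{1}{C_W A^{1+d}M_d},\tfrac{\gamma}{2}\Bigr)<\infty,$$ and for every (complex-valued) $f\in L^2(\mathbb{R}^d)$ satisfying $$\int_{\mathbb{R}^d}|\widehat f(\xi)\,W(|\xi|)|^2\,dm_d(\xi)\le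 C_W^2\,\|f\|_{L^2(\mathbb{R}^d)}^2$$ and every $(\gamma,1)$-relatively dense set $E\subset\mathbb{R}^d$, $$\int_{\mathbb{R}^d}|f|^2\,dm_d\le \frac{4}{\gamma}\,\Theta_{\mathcal{M}_A}\Bigl(d,\frac{1}{C_W A^{1+d}M_d},\frac{\gamma}{2}\Bigr)^2\int_E|f|^2\,dm_d .$$ -/

import Mathlib

open MeasureTheory Filter Topology FourierTransform
open scoped NNReal ENNReal ContDiff

noncomputable section

/-- The weights `W : [0,∞) → [0,∞]` under consideration: `W ≡ 1` on `[0,1]` (in particular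
`W 0 = 1`), `W` is non-decreasing, lower semicontinuous, tends to `∞` at infinity, and
`log r ↦ log W(r)` is convex on `r ∈ [1,∞)`. The value `∞` is allowed. -/
structure IsWeight (W : ℝ≥0 → ℝ≥0∞) : Prop where
  eq_one : ∀ t ≤ 1, W t = 1
  mono : Monotone W
  lsc : LowerSemicontinuous W
  tendsto_top : Tendsto W atTop (𝓝 ⊤)
  /-- With `r = exp x`, `s = exp y`, this is Jensen's inequality for `log ∘ W ∘ exp`
  on `[0,∞)`, as an inequality in `[0,∞]`. -/
  log_convex : ∀ x y a b : ℝ, 0 ≤ x → 0 ≤ y → 0 ≤ a → 0 ≤ b → a + b = 1 →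
    ENNReal.log (W (Real.exp (a * x + b * y)).toNNReal) ≤
      (a : EReal) * ENNReal.log (W (Real.exp x).toNNReal) +
        (b : EReal) * ENNReal.log (W (Real.exp y).toNNReal)

/-- `∫₀^∞ log W(t) / (1 + t²) dt`, as an element of `[0,∞]` (for weights with `1 ≤ W`,
so that `log W` takes its values in `[0,∞]`). -/
def logIntegral (W : ℝ≥0 → ℝ≥0∞) : ℝ≥0∞ :=
  ∫⁻ t : ℝ in Set.Ioi 0, (ENNReal.log (W t.toNNReal)).toENNReal / ENNReal.ofReal (1 + t ^ 2)

/-- `M_n = sup_{t ≥ 0} t^n / W(t)`. -/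
def weightSeq (W : ℝ≥0 → ℝ≥0∞) (n : ℕ) : ℝ≥0∞ :=
  ⨆ t : ℝ≥0, (t : ℝ≥0∞) ^ n / W t

/-- The modified sequence `M̃_0 = 1` and `M̃_n = A^n M_{n+d} / M_d` for `n ≥ 1`. -/
def modifiedSeq (M : ℕ → ℝ≥0∞) (A : ℝ≥0) (d : ℕ) (n : ℕ) : ℝ≥0∞ :=
  if n = 0 then 1 else (A : ℝ≥0∞) ^ n * M (n + d) / M d

/-- The closed axis-parallel cube of side-length `l` with lowest corner `a`. -/
def cube {d : ℕ} (a : EuclideanSpace ℝ (Fin d)) (l : ℝ) : Set (EuclideanSpace ℝ (Fin d)) :=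
  {x | ∀ i, a i ≤ x i ∧ x i ≤ a i + l}

/-- A Borel set `E` is `(γ, l)`-relatively dense if `|E ∩ Q| ≥ γ` for every cube `Q` of
side-length `l`. -/
def IsRelativelyDense {d : ℕ} (γ : ℝ≥0) (l : ℝ) (E : Set (EuclideanSpace ℝ (Fin d))) : Prop :=
  MeasurableSet E ∧ ∀ a : EuclideanSpace ℝ (Fin d), (γ : ℝ≥0∞) ≤ volume (E ∩ cube a l)

/-- The class `C_M(Q)`: smooth real functions on `Q` all of whose partial derivatives of order `n`
are bounded on `Q` by `M n`, for every `n`. The tuple `i` lists the directions of the successive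
differentiations, so that these are the derivatives `D^α` with `|α| = n`. -/
def MemClass {d : ℕ} (M : ℕ → ℝ≥0∞) (Q : Set (EuclideanSpace ℝ (Fin d)))
    (f : EuclideanSpace ℝ (Fin d) → ℝ) : Prop :=
  ContDiffOn ℝ ∞ f Q ∧
    ∀ (n : ℕ) (i : Fin n → Fin d), ∀ x ∈ Q,
      ‖iteratedFDerivWithin ℝ n f Q x (fun k => EuclideanSpace.single (i k) (1 : ℝ))‖ₑ ≤ M n

/-- `IsRemezConst M d t s C` says that `‖f‖_{L^∞(Q)} ≤ C ‖f‖_{L^∞(E)}` for every cube `Q ⊆ ℝ^d` of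
side-length `1`, every `f ∈ C_M(Q)` with `‖f‖_{L^∞(Q)} ≥ t`, and every Borel set `E ⊆ Q` of
measure at least `s`. -/
def IsRemezConst (M : ℕ → ℝ≥0∞) (d : ℕ) (t s C : ℝ≥0∞) : Prop :=
  ∀ (a : EuclideanSpace ℝ (Fin d)) (f : EuclideanSpace ℝ (Fin d) → ℝ)
    (E : Set (EuclideanSpace ℝ (Fin d))),
    MemClass M (cube a 1) f → t ≤ eLpNorm f ∞ (volume.restrict (cube a 1)) →
    MeasurableSet E → E ⊆ cube a 1 → s ≤ volume E →
    eLpNorm f ∞ (volume.restrict (cube a 1)) ≤ C * eLpNorm f ∞ (volume.restrict E)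

/-- `Θ_M(d, t, s)`: the least constant in the above inequality (`∞` if there is none). -/
def remezConst (M : ℕ → ℝ≥0∞) (d : ℕ) (t s : ℝ≥0∞) : ℝ≥0∞ :=
  sInf {C | IsRemezConst M d t s C}

end

/-! The proof has two halves: finiteness of Θ, and the energy estimate with Θ as a black box.

Finiteness is a quantitative Denjoy–Carleman theorem. The sequence M_n is log-convex. A supporting
line of log W in the logarithmic variable gives log W(t) ≤ log t + ∑ log⁺(t M_k / M_{k+1}) for
almost every t ≥ 1. Integrating against dt/t² bounds the logarithmic integral by 1 + ∑ M_k /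
M_{k+1}, so that series diverges (`IsWeight.not_summable_weightSeq`) and the class is
quasi-analytic. Bang's argument makes this effective. The level N of a point records that |h_j| ≤
e^{j-N} M_j for j < N, and a move of length e^{-1} M_N / M_{N+1} lowers the level from N + 1 to N
(`bang_step`). By divergence, a high enough starting level survives a move across a unit interval. A
function that is tiny on a set of measure s has many tiny derivatives at some point of that set,
hence is small on the whole interval (`exists_remez_interval`). Fubini, one coordinate at a time,
carries this to cubes (`exists_remez_lmarginal`).

For the estimate, t^n ≤ M_n W(t) and Plancherel give a smooth representative u of f whose
derivatives of order n have L² norm at most (2π)^n M_n C_W ‖f‖. Space is cut into integer unit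
cubes. A cube is good if its local L² norms of derivatives are at most B^{n+1} M_n C_W times the
local norm of u, for every order n and every choice of directions. With B = 32d the bad cubes carry
at most half of the mass (`tsum_bad_le`). On a good cube, a Sobolev bound with d extra derivatives
puts a multiple of the real part of a rotation of u into the class of M̃. That multiple is large
enough to meet the threshold of Θ. The Remez inequality on the part of E where |u|² is at most 2/γ
times its integral over E ∩ Q then bounds the mass of the cube (`lintegral_cube_le_remezConst`).
Summing over cubes and absorbing the bad half doubles 2/γ to 4/γ. -/

/-! ### Taylor bounds and Bang's propagation of smallness -/

/-- Taylor's inequality on `[0, 1]` for a family of successive derivatives. -/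
lemma taylor_bound_unit (N : ℕ) : ∀ (g : ℕ → ℝ → ℝ) (K : ℝ),
    (∀ n, ∀ y ∈ Set.Icc (0 : ℝ) 1, HasDerivWithinAt (g n) (g (n + 1) y) (Set.Icc 0 1) y) →
    (∀ y ∈ Set.Icc (0 : ℝ) 1, |g N y| ≤ K) →
    ∀ y ∈ Set.Icc (0 : ℝ) 1,
      |g 0 y| ≤ ∑ i ∈ Finset.range N, |g i 0| * y ^ i / i.factorial + K * y ^ N / N.factorial := by
  induction N with
  | zero => intro g K _ hK y hy; simpa using hK y hy
  | succ N ih =>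
    intro g K hg hK
    have key := ih (fun n => g (n + 1)) K (fun n => hg (n + 1)) hK
    -- `B` is the claimed bound. Its derivative is the bound that the induction hypothesis gives for
    -- `g 1`, so a comparison of derivatives suffices.
    set B : ℝ → ℝ := fun y => ∑ i ∈ Finset.range (N + 1), |g i 0| * y ^ i / i.factorial +
      K * y ^ (N + 1) / (N + 1).factorial with hB
    have hpow : ∀ (c : ℝ) (i : ℕ) (y : ℝ), HasDerivAt
        (fun y : ℝ => c * y ^ (i + 1) / (i + 1).factorial) (c * y ^ i / i.factorial) y := by
      intro c i y
      have h1 := ((hasDerivAt_pow (i + 1) y).const_mul c).div_const ((i + 1).factorial : ℝ)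
      refine h1.congr_deriv ?_
      have : (i.factorial : ℝ) ≠ 0 := by positivity
      have h3 : ((i : ℝ) + 1) ≠ 0 := by positivity
      rw [Nat.factorial_succ, Nat.add_sub_cancel]; push_cast
      field_simp
    have hB' : ∀ y, HasDerivAt B
        (∑ i ∈ Finset.range N, |g (i + 1) 0| * y ^ i / i.factorial + K * y ^ N / N.factorial) y := by
      intro y
      have h2 : B = fun y => (∑ i ∈ Finset.range N, |g (i + 1) 0| * y ^ (i + 1) / (i + 1).factorial
          + |g 0 0|) + K * y ^ (N + 1) / (N + 1).factorial := by
        funext y; simp [hB, Finset.sum_range_succ']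
      rw [h2]
      refine HasDerivAt.add (HasDerivAt.add_const _ ?_) (hpow _ _ _)
      exact HasDerivAt.fun_sum fun i _ => hpow _ _ _
    intro y hy
    refine image_norm_le_of_norm_deriv_right_le_deriv_boundary' (f := g 0) (f' := g 1) (a := 0)
      (b := 1) (B := B) (fun y hy => (hg 0 y hy).continuousWithinAt)
      (fun y hy => ?_) ?_ (fun y _ => (hB' y).continuousAt.continuousWithinAt)
      (fun y _ => (hB' y).hasDerivWithinAt) (fun y hy => ?_) hy
    · exact ((hg 0 y ⟨hy.1, hy.2.le⟩).mono_of_mem_nhdsWithin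
        (mem_of_superset (Icc_mem_nhdsGE hy.2) (Set.Icc_subset_Icc_left hy.1)))
    · simp [hB, Finset.sum_range_succ']
    · exact key y ⟨hy.1, hy.2.le⟩

/-- Taylor's inequality on an interval for a family of successive derivatives. -/
lemma taylor_bound {a b : ℝ} (h : ℕ → ℝ → ℝ)
    (hh : ∀ n, ∀ y ∈ Set.Icc a b, HasDerivWithinAt (h n) (h (n + 1) y) (Set.Icc a b) y)
    (N : ℕ) (K : ℝ) (hK : ∀ y ∈ Set.Icc a b, |h N y| ≤ K)
    {x y : ℝ} (hx : x ∈ Set.Icc a b) (hy : y ∈ Set.Icc a b) :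
    |h 0 y| ≤ ∑ i ∈ Finset.range N, |h i x| * |y - x| ^ i / i.factorial +
      K * |y - x| ^ N / N.factorial := by
  have hmem : ∀ τ ∈ Set.Icc (0 : ℝ) 1, x + τ * (y - x) ∈ Set.Icc a b := fun τ hτ => by
    have := (convex_Icc a b).add_smul_sub_mem hx hy hτ
    simpa using this
  -- Parametrising the segment from x to y by [0, 1] treats y < x and y > x alike.
  have key := taylor_bound_unit N (fun n τ => (y - x) ^ n * h n (x + τ * (y - x)))
    (|y - x| ^ N * K) ?_ ?_ 1 (by simp)
  · simp only [pow_zero, one_mul, zero_mul, add_zero, one_pow, mul_one, abs_mul, abs_pow] at key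
    rw [add_sub_cancel] at key
    convert key using 2
    · exact Finset.sum_congr rfl fun i _ => by ring
    · ring
  · intro n τ hτ
    have h1 : HasDerivWithinAt (fun τ : ℝ => x + τ * (y - x)) (y - x) (Set.Icc 0 1) τ := by
      simpa using (((hasDerivAt_id τ).mul_const (y - x)).const_add x).hasDerivWithinAt
    have h2 := ((hh n _ (hmem τ hτ)).comp τ h1 hmem).const_mul ((y - x) ^ n)
    exact h2.congr_deriv (by ring)
  · intro τ hτ
    simp only [abs_mul, abs_pow]
    gcongr
    exact hK _ (hmem τ hτ)

/-- Log-convexity makes the ratios M (n+1) / M n increasing, and the i ratios leading from j to j +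
i all have index at most N. -/
lemma ratio_le_pow {M : ℕ → ℝ} (hM : ∀ n, 0 < M n)
    (hconv : ∀ n, M (n + 1) ^ 2 ≤ M n * M (n + 2)) {j i N : ℕ} (h : j + i ≤ N + 1) :
    M (j + i) ≤ M j * (M (N + 1) / M N) ^ i := by
  have hmono : Monotone fun n => M (n + 1) / M n := by
    refine monotone_nat_of_le_succ fun n => ?_
    rw [div_le_div_iff₀ (hM _) (hM _)]
    nlinarith [hconv n]
  induction i with
  | zero => simp
  | succ i ih =>
    have h1 : M (j + i + 1) / M (j + i) ≤ M (N + 1) / M N := hmono (by omega : j + i ≤ N)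
    rw [div_le_iff₀ (hM _)] at h1
    calc M (j + (i + 1)) ≤ M (N + 1) / M N * M (j + i) := h1
      _ ≤ M (N + 1) / M N * (M j * (M (N + 1) / M N) ^ i) := by
        have := (div_pos (hM (N + 1)) (hM N)).le
        gcongr
        exact ih (by omega)
      _ = _ := by ring

/-- The propagation step in Bang's proof of the Denjoy–Carleman theorem. -/
lemma bang_step {a b : ℝ} {M : ℕ → ℝ} (hM : ∀ n, 0 < M n)
    (hconv : ∀ n, M (n + 1) ^ 2 ≤ M n * M (n + 2)) {h : ℕ → ℝ → ℝ}
    (hh : ∀ n, ∀ y ∈ Set.Icc a b, HasDerivWithinAt (h n) (h (n + 1) y) (Set.Icc a b) y)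
    (hb : ∀ n, ∀ y ∈ Set.Icc a b, |h n y| ≤ M n) {N : ℕ} {x y : ℝ} (hx : x ∈ Set.Icc a b)
    (hy : y ∈ Set.Icc a b) (hxy : |y - x| ≤ Real.exp (-1) * (M N / M (N + 1)))
    (hP : ∀ j < N + 1, |h j x| ≤ Real.exp (j - (N + 1 : ℕ)) * M j) :
    ∀ j < N, |h j y| ≤ Real.exp (j - N) * M j := by
  intro j hj
  have hT := taylor_bound (fun n => h (j + n)) (fun n => hh (j + n)) (N + 1 - j) (M (N + 1))
    (fun y hy => by
      have := hb (N + 1) y hy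
      rwa [show j + (N + 1 - j) = N + 1 by omega]) hx hy
  simp only [add_zero] at hT
  set u : ℝ := Real.exp 1 * (M (N + 1) / M N) * |y - x| with hu
  have hr : 0 < M (N + 1) / M N := div_pos (hM _) (hM _)
  have hu0 : 0 ≤ u := by positivity
  have hu1 : u ≤ 1 := by
    calc u ≤ Real.exp 1 * (M (N + 1) / M N) * (Real.exp (-1) * (M N / M (N + 1))) := by
          rw [hu]; gcongr
      _ = 1 := by
        have h1 := (hM N).ne'
        have h2 := (hM (N + 1)).ne'
        rw [Real.exp_neg]
        field_simp
  set c : ℝ := Real.exp (j - (N + 1 : ℕ)) * M j with hc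
  have hc0 : 0 < c := mul_pos (Real.exp_pos _) (hM j)
  -- At order j + i = N + 1 the exponential factor is 1, so the a priori bound on the Taylor
  -- remainder has the same form as the smallness hypotheses. The whole Taylor sum is then at most
  -- c·e^u ≤ c·e, and this factor e is exactly the loss of one level.
  have hterm : ∀ i, j + i ≤ N + 1 → Real.exp ((j + i : ℕ) - (N + 1 : ℕ)) * M (j + i) * |y - x| ^ i
      / i.factorial ≤ c * (u ^ i / i.factorial) := by
    intro i hi
    have h1 := ratio_le_pow hM hconv hi
    have h2 : Real.exp ((j + i : ℕ) - (N + 1 : ℕ)) =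
        Real.exp (j - (N + 1 : ℕ)) * Real.exp 1 ^ i := by
      rw [← Real.exp_nat_mul, ← Real.exp_add]; congr 1; push_cast; ring
    rw [mul_div_assoc']
    refine div_le_div_of_nonneg_right ?_ (by positivity)
    calc _ ≤ Real.exp ((j + i : ℕ) - (N + 1 : ℕ)) * (M j * (M (N + 1) / M N) ^ i) * |y - x| ^ i := by
          gcongr
      _ = _ := by rw [h2, hu, hc]; ring
  have hsum : |h j y| ≤ c * ∑ i ∈ Finset.range (N + 1 - j + 1), u ^ i / i.factorial := by
    refine hT.trans ?_
    rw [Finset.sum_range_succ, mul_add, Finset.mul_sum]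
    refine add_le_add (Finset.sum_le_sum fun i hi => ?_) ?_
    · have hi' := Finset.mem_range.1 hi
      refine le_trans ?_ (hterm i (by omega))
      gcongr
      exact hP (j + i) (by omega)
    · refine le_trans (le_of_eq ?_) (hterm _ (by omega))
      rw [show j + (N + 1 - j) = N + 1 by omega]
      simp
  calc |h j y| ≤ c * Real.exp u := hsum.trans (by gcongr; exact Real.sum_le_exp_of_nonneg hu0 _)
    _ ≤ c * Real.exp 1 := by gcongr
    _ = Real.exp (j - N) * M j := by
      rw [hc, mul_right_comm, ← Real.exp_add]; congr 2; push_cast; ring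

/-- Bang's propagation of smallness of all derivatives at one point. -/
lemma bang_propagation {a b : ℝ} {M : ℕ → ℝ} (hM : ∀ n, 0 < M n)
    (hconv : ∀ n, M (n + 1) ^ 2 ≤ M n * M (n + 2)) {h : ℕ → ℝ → ℝ}
    (hh : ∀ n, ∀ y ∈ Set.Icc a b, HasDerivWithinAt (h n) (h (n + 1) y) (Set.Icc a b) y)
    (hb : ∀ n, ∀ y ∈ Set.Icc a b, |h n y| ≤ M n) {K : ℕ} (n : ℕ) :
    ∀ {x y : ℝ}, x ∈ Set.Icc a b → y ∈ Set.Icc a b →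
    |y - x| ≤ ∑ i ∈ Finset.range n, Real.exp (-1) * (M (K + i) / M (K + i + 1)) →
    (∀ j < K + n, |h j x| ≤ Real.exp (j - (K + n : ℕ)) * M j) →
    ∀ j < K, |h j y| ≤ Real.exp (j - K) * M j := by
  induction n with
  | zero =>
    intro x y hx hy hxy hP
    obtain rfl : y = x := by simpa [sub_eq_zero] using hxy
    exact hP
  | succ n ih =>
    intro x y hx hy hxy hP
    rw [Finset.sum_range_succ] at hxy
    set δ := Real.exp (-1) * (M (K + n) / M (K + n + 1)) with hδ
    set σ := ∑ i ∈ Finset.range n, Real.exp (-1) * (M (K + i) / M (K + i + 1)) with hσ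
    have hδ0 : 0 < δ := mul_pos (Real.exp_pos _) (div_pos (hM _) (hM _))
    have hσ0 : 0 ≤ σ := Finset.sum_nonneg fun i _ =>
      (mul_pos (Real.exp_pos _) (div_pos (hM _) (hM _))).le
    -- The segment from x to y is divided in the ratio δ : σ. The first piece has length at most δ
    -- and is one Bang step; the second has length at most σ and is left to the induction
    -- hypothesis.
    have hτ : δ / (σ + δ) ∈ Set.Icc (0 : ℝ) 1 :=
      ⟨by positivity, (div_le_one (by positivity)).2 (by linarith)⟩
    have hz : x + δ / (σ + δ) * (y - x) ∈ Set.Icc a b := by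
      simpa using (convex_Icc a b).add_smul_sub_mem hx hy hτ
    refine ih hz hy ?_ (bang_step hM hconv hh hb hx hz ?_ hP)
    · rw [show y - (x + δ / (σ + δ) * (y - x)) = σ / (σ + δ) * (y - x) by field_simp; ring,
        abs_mul, abs_of_nonneg (by positivity)]
      calc _ ≤ σ / (σ + δ) * (σ + δ) := by gcongr
        _ = σ := by field_simp
    · rw [add_sub_cancel_left, abs_mul, abs_of_nonneg hτ.1]
      calc _ ≤ δ / (σ + δ) * (σ + δ) := by gcongr
        _ = δ := by field_simp

/-! ### From smallness on a set of positive measure to an interval -/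

/-- If a function is small on a set of given measure, then its derivative is small on a
substantial part of the set. -/
lemma exists_small_deriv {K s η : ℝ} (hK : 0 < K) (hs : 0 < s) (hη : 0 < η) :
    ∃ ε > 0, ∀ (a : ℝ) (f f' : ℝ → ℝ) (E : Set ℝ),
      (∀ y ∈ Set.Icc a (a + 1), HasDerivWithinAt f (f' y) (Set.Icc a (a + 1)) y) →
      (∀ x ∈ Set.Icc a (a + 1), ∀ y ∈ Set.Icc a (a + 1), |f' y - f' x| ≤ K * |y - x|) →
      E ⊆ Set.Icc a (a + 1) → ENNReal.ofReal s ≤ volume E → (∀ x ∈ E, |f x| ≤ ε) →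
      ∃ E' ⊆ E, ENNReal.ofReal (s / 2) ≤ volume E' ∧ ∀ x ∈ E', |f' x| ≤ η := by
  -- On a piece of length 1/n the derivative varies by less than η/2. A piece that meets `B` at a
  -- point x therefore has |f'| ≥ η/2 to the right of x, which makes f strictly monotone there.
  obtain ⟨n, hn⟩ := exists_nat_gt (K / (η / 2))
  have hn0 : (0 : ℝ) < n := lt_trans (by positivity) hn
  rw [div_lt_iff₀ (by positivity)] at hn
  -- The value of ε is set by 2ε = (η/2) · s/(2(n+1)): two points of `B` in the same piece are at
  -- most s/(2(n+1)) apart. There are n + 1 pieces because the right endpoint a + 1 has floor index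
  -- n.
  refine ⟨s * η / (8 * (n + 1)), by positivity, fun a f f' E hf hlip hE hsE hfE => ?_⟩
  refine ⟨E ∩ {x | |f' x| ≤ η}, Set.inter_subset_left, ?_, fun x hx => hx.2⟩
  set B := E ∩ {x | η < |f' x|} with hB
  have hEsub : E ⊆ (E ∩ {x | |f' x| ≤ η}) ∪ B := fun x hx => by
    by_cases h : |f' x| ≤ η
    · exact Or.inl ⟨hx, h⟩
    · exact Or.inr ⟨hx, not_le.1 h⟩
  have hpiece : ∀ k : ℕ, volume (B ∩ Set.Icc (a + k / n) (a + (k + 1) / n)) ≤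
      ENNReal.ofReal (s / (2 * (n + 1))) := by
    intro k
    refine (Real.volume_le_diam _).trans (Metric.ediam_le fun x hx y hy => ?_)
    have main : ∀ x ∈ B ∩ Set.Icc (a + k / n) (a + (k + 1) / n),
        ∀ y ∈ B ∩ Set.Icc (a + k / n) (a + (k + 1) / n), x < y → y - x ≤ s / (2 * (n + 1)) := by
      intro x hx y hy hxy
      have hxI := hE hx.1.1
      have hyI := hE hy.1.1
      have hsub : Set.Icc x y ⊆ Set.Icc a (a + 1) := Set.Icc_subset_Icc hxI.1 hyI.2
      obtain ⟨c, hc, hfc⟩ := exists_hasDerivAt_eq_slope f f' hxy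
        (fun z hz => (hf z (hsub hz)).continuousWithinAt.mono hsub)
        (fun z hz => (hf z (hsub ⟨hz.1.le, hz.2.le⟩)).hasDerivAt
          (Icc_mem_nhds (hxI.1.trans_lt hz.1) (hz.2.trans_le hyI.2)))
      have h1 := hlip x hxI c (hsub ⟨hc.1.le, hc.2.le⟩)
      have h2 : |c - x| ≤ 1 / n := by
        rw [abs_of_pos (sub_pos.2 hc.1)]
        have := hx.2.1; have := hy.2.2
        have h3 : ((k : ℝ) + 1) / n = k / n + 1 / n := by ring
        linarith [hc.2]
      have h4 : K * |c - x| ≤ η / 2 := by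
        calc K * |c - x| ≤ K * (1 / n) := by gcongr
          _ ≤ η / 2 := by rw [mul_one_div, div_le_iff₀ hn0]; linarith
      have h5 : η / 2 ≤ |f' c| := by
        have h6 : η < |f' x| := hx.1.2
        have := abs_sub_abs_le_abs_sub (f' x) (f' c)
        rw [abs_sub_comm] at this
        linarith
      have h7 : |f y - f x| ≤ 2 * (s * η / (8 * (n + 1))) := by
        have := abs_sub (f y) (f x)
        linarith [hfE x hx.1.1, hfE y hy.1.1]
      rw [eq_div_iff (sub_pos.2 hxy).ne'] at hfc
      rw [← hfc, abs_mul, abs_of_pos (sub_pos.2 hxy)] at h7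
      have h8 : η / 2 * (y - x) ≤ 2 * (s * η / (8 * (n + 1))) :=
        (mul_le_mul_of_nonneg_right h5 (sub_pos.2 hxy).le).trans h7
      have h9 : 2 * (s * η / (8 * (n + 1))) = η / 2 * (s / (2 * (n + 1))) := by field_simp; ring
      rw [h9] at h8
      exact le_of_mul_le_mul_left h8 (by positivity)
    rw [edist_dist, Real.dist_eq]
    refine ENNReal.ofReal_le_ofReal ?_
    rcases lt_trichotomy x y with h | h | h
    · rw [abs_sub_comm, abs_of_pos (sub_pos.2 h)]; exact main x hx y hy h
    · rw [h, sub_self, abs_zero]; positivity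
    · rw [abs_of_pos (sub_pos.2 h)]; exact main y hy x hx h
  have hBcov : B ⊆ ⋃ k ∈ Finset.range (n + 1), B ∩ Set.Icc (a + k / n) (a + (k + 1) / n) := by
    intro x hx
    have hxI := hE hx.1
    have h0 : 0 ≤ (x - a) * n := mul_nonneg (by linarith [hxI.1]) hn0.le
    have h1 : (x - a) * n ≤ n := by nlinarith [hxI.2]
    refine Set.mem_biUnion (x := ⌊(x - a) * n⌋₊) ?_ ⟨hx, ?_, ?_⟩
    · simpa [Nat.lt_succ_iff] using Nat.floor_le_of_le h1
    · have := Nat.floor_le h0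
      rw [← div_le_iff₀ hn0] at this
      linarith
    · have := (Nat.lt_floor_add_one ((x - a) * n)).le
      rw [← le_div_iff₀ hn0] at this
      linarith
  have hBvol : volume B ≤ ENNReal.ofReal (s / 2) := by
    calc volume B ≤ ∑ k ∈ Finset.range (n + 1),
          volume (B ∩ Set.Icc (a + k / n) (a + (k + 1) / n)) :=
        (measure_mono hBcov).trans (measure_biUnion_finset_le _ _)
      _ ≤ ∑ k ∈ Finset.range (n + 1), ENNReal.ofReal (s / (2 * (n + 1))) :=
        Finset.sum_le_sum fun k _ => hpiece k
      _ = ENNReal.ofReal (s / 2) := by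
        rw [Finset.sum_const, Finset.card_range, ← ENNReal.ofReal_nsmul]
        congr 1
        rw [nsmul_eq_mul]; push_cast; field_simp
  have h1 := hsE.trans ((measure_mono hEsub).trans (measure_union_le _ _))
  have h2 := h1.trans (add_le_add_right hBvol _)
  rw [← add_halves s, ENNReal.ofReal_add (by positivity) (by positivity), add_halves s] at h2
  exact (ENNReal.add_le_add_iff_right ENNReal.ofReal_ne_top).1 h2

/-- If a function is small on a set of given measure, then at some point finitely many of its
derivatives are small. -/
lemma exists_small_derivs {M : ℕ → ℝ} (hM : ∀ n, 0 < M n) (N : ℕ) :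
    ∀ {s η : ℝ}, 0 < s → 0 < η → ∃ ε > 0, ∀ (a : ℝ) (h : ℕ → ℝ → ℝ) (E : Set ℝ),
      (∀ n, ∀ y ∈ Set.Icc a (a + 1),
        HasDerivWithinAt (h n) (h (n + 1) y) (Set.Icc a (a + 1)) y) →
      (∀ n, ∀ y ∈ Set.Icc a (a + 1), |h n y| ≤ M n) →
      E ⊆ Set.Icc a (a + 1) → ENNReal.ofReal s ≤ volume E → (∀ x ∈ E, |h 0 x| ≤ ε) →
      ∃ E' ⊆ E, ENNReal.ofReal (s / 2 ^ N) ≤ volume E' ∧ ∀ j ≤ N, ∀ x ∈ E', |h j x| ≤ η := by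
  induction N with
  | zero =>
    intro s η hs hη
    refine ⟨η, hη, fun a h E _ _ _ hsE hE => ⟨E, subset_rfl, by simpa using hsE, ?_⟩⟩
    intro j hj x hx
    obtain rfl : j = 0 := by omega
    exact hE x hx
  | succ N ih =>
    intro s η hs hη
    -- The constants are chosen backwards: ε₁ is what the last differentiation requires of `h N`,
    -- and the earlier derivatives are then made smaller than it. The bound M (N + 2) serves as
    -- Lipschitz constant of `h (N + 1)`.
    obtain ⟨ε₁, hε₁, H₁⟩ := exists_small_deriv (hM (N + 2)) (s := s / 2 ^ N) (by positivity) hη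
    obtain ⟨ε₂, hε₂, H₂⟩ := ih hs (lt_min hη hε₁)
    refine ⟨ε₂, hε₂, fun a h E hh hb hEI hsE hE => ?_⟩
    obtain ⟨E₁, hE₁, hs₁, hj₁⟩ := H₂ a h E hh hb hEI hsE hE
    obtain ⟨E₂, hE₂, hs₂, hj₂⟩ := H₁ a (h N) (h (N + 1)) E₁ (hh N) (fun x hx y hy =>
      (convex_Icc a (a + 1)).norm_image_sub_le_of_norm_hasDerivWithin_le (hh (N + 1))
        (hb (N + 2)) hx hy) (hE₁.trans hEI) hs₁
      fun x hx => (hj₁ N le_rfl x hx).trans (min_le_right _ _)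
    refine ⟨E₂, hE₂.trans hE₁, by rwa [pow_succ, ← div_div], fun j hj x hx => ?_⟩
    rcases Nat.lt_or_ge N j with hjN | hjN
    · obtain rfl : j = N + 1 := by omega
      exact hj₂ x hx
    · exact (hj₁ j hjN x (hE₂ hx)).trans (min_le_left _ _)

/-- A qualitative Remez inequality on an interval of length one for a quasi-analytic class. -/
lemma exists_remez_interval {M : ℕ → ℝ} (hM : ∀ n, 0 < M n)
    (hconv : ∀ n, M (n + 1) ^ 2 ≤ M n * M (n + 2)) (hdiv : ¬ Summable fun n => M n / M (n + 1))
    {s t : ℝ} (hs : 0 < s) (ht : 0 < t) :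
    ∃ ε > 0, ∀ (a : ℝ) (h : ℕ → ℝ → ℝ) (E : Set ℝ),
      (∀ n, ∀ y ∈ Set.Icc a (a + 1),
        HasDerivWithinAt (h n) (h (n + 1) y) (Set.Icc a (a + 1)) y) →
      (∀ n, ∀ y ∈ Set.Icc a (a + 1), |h n y| ≤ M n) →
      E ⊆ Set.Icc a (a + 1) → ENNReal.ofReal s ≤ volume E → (∀ x ∈ E, |h 0 x| ≤ ε) →
      ∀ y ∈ Set.Icc a (a + 1), |h 0 y| ≤ t := by
  -- Level K at y already gives |h 0 y| ≤ e^{-K} M 0 ≤ t, so K is the level that must survive.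
  obtain ⟨K, hK0, hK⟩ : ∃ K : ℕ, 0 < K ∧ Real.exp (-K) * M 0 ≤ t := by
    obtain ⟨K, hK⟩ := exists_nat_gt (Real.log (M 0 / t))
    refine ⟨K + 1, K.succ_pos, ?_⟩
    have h1 : M 0 / t ≤ Real.exp (K + 1 : ℕ) := by
      rw [← Real.log_le_iff_le_exp (div_pos (hM 0) ht)]; push_cast; linarith
    rw [div_le_iff₀ ht] at h1
    rw [Real.exp_neg, inv_mul_le_iff₀ (Real.exp_pos _)]
    exact h1
  have hterm : ∀ i, 0 ≤ Real.exp (-1) * (M (K + i) / M (K + i + 1)) := fun i =>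
    (mul_pos (Real.exp_pos _) (div_pos (hM _) (hM _))).le
  have hdiv' : ¬ Summable fun i => Real.exp (-1) * (M (K + i) / M (K + i + 1)) := by
    rw [summable_mul_left_iff (Real.exp_pos _).ne']
    intro h
    refine hdiv ((summable_nat_add_iff K).1 ?_)
    simpa only [add_comm K] using h
  -- Divergence is used here: n further levels allow a total displacement of at least 1, the length
  -- of the interval.
  obtain ⟨n, hn⟩ := ((not_summable_iff_tendsto_nat_atTop_of_nonneg hterm).1 hdiv').eventually_ge_atTop 1 |>.exists
  obtain ⟨η, hη, hηle⟩ : ∃ η > 0, ∀ j < K + n, η ≤ Real.exp (j - (K + n : ℕ)) * M j := by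
    generalize hc : (fun j : ℕ => Real.exp (j - (K + n : ℕ)) * M j) = c
    have hcpos : ∀ j, 0 < c j := fun j => by
      rw [← hc]; exact mul_pos (Real.exp_pos _) (hM j)
    suffices h : ∀ m : ℕ, ∃ η > 0, ∀ j < m, η ≤ c j by
      obtain ⟨η, hη, h⟩ := h (K + n)
      exact ⟨η, hη, fun j hj => (h j hj).trans_eq (congrFun hc j).symm⟩
    intro m
    induction m with
    | zero => exact ⟨1, one_pos, by simp⟩
    | succ m ih =>
      obtain ⟨η, hη, h⟩ := ih
      refine ⟨min η (c m), lt_min hη (hcpos m), fun j hj => ?_⟩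
      rcases Nat.lt_succ_iff_lt_or_eq.1 hj with h' | rfl
      · exact (min_le_left _ _).trans (h j h')
      · exact min_le_right _ _
  obtain ⟨ε, hε, H⟩ := exists_small_derivs hM (K + n) hs hη
  refine ⟨ε, hε, fun a h E hh hb hEI hsE hE y hy => ?_⟩
  obtain ⟨E', hE', hs', hj⟩ := H a h E hh hb hEI hsE hE
  obtain ⟨x, hx⟩ : E'.Nonempty := by
    refine nonempty_of_measure_ne_zero (μ := volume) (ne_of_gt (lt_of_lt_of_le ?_ hs'))
    rw [ENNReal.ofReal_pos]; positivity
  have hxI := hEI (hE' hx)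
  have := bang_propagation hM hconv hh hb n hxI hy ?_
    (fun j hj' => (hj j hj'.le x hx).trans (hηle j hj')) 0 hK0
  · refine this.trans (le_trans (le_of_eq ?_) hK)
    simp
  · refine le_trans ?_ hn
    rw [abs_le]
    constructor <;> linarith [hxI.1, hxI.2, hy.1, hy.2]

/-! ### The Remez inequality on cubes -/

lemma cube_eq_preimage {d : ℕ} (a : EuclideanSpace ℝ (Fin d)) (l : ℝ) :
    cube a l = (EuclideanSpace.equiv (Fin d) ℝ) ⁻¹'
      (Set.univ.pi fun i => Set.Icc (a i) (a i + l)) := by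
  ext x
  exact ⟨fun h i _ => h i, fun h i => h i trivial⟩

lemma toLp_mem_cube {d : ℕ} {a : EuclideanSpace ℝ (Fin d)} {l : ℝ} {p : Fin d → ℝ} :
    WithLp.toLp 2 p ∈ cube a l ↔ ∀ i, p i ∈ Set.Icc (a i) (a i + l) := Iff.rfl

lemma uniqueDiffOn_cube {d : ℕ} (a : EuclideanSpace ℝ (Fin d)) {l : ℝ} (hl : 0 < l) :
    UniqueDiffOn ℝ (cube a l) := by
  rw [cube_eq_preimage]
  exact (EuclideanSpace.equiv (Fin d) ℝ).uniqueDiffOn_preimage_iff.2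
    (UniqueDiffOn.univ_pi fun i => uniqueDiffOn_Icc (by linarith))

lemma isClosed_cube {d : ℕ} (a : EuclideanSpace ℝ (Fin d)) (l : ℝ) : IsClosed (cube a l) := by
  rw [cube_eq_preimage]
  exact (isClosed_set_pi fun i _ => isClosed_Icc).preimage
    (EuclideanSpace.equiv (Fin d) ℝ).continuous

lemma update_mem_cube {d : ℕ} {a : EuclideanSpace ℝ (Fin d)} {l : ℝ} {p : Fin d → ℝ}
    (hp : WithLp.toLp 2 p ∈ cube a l) {i : Fin d} {y : ℝ} (hy : y ∈ Set.Icc (a i) (a i + l)) :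
    WithLp.toLp 2 (Function.update p i y) ∈ cube a l := by
  rw [toLp_mem_cube] at hp ⊢
  intro j
  by_cases h : j = i
  · subst h; simpa using hy
  · simpa [h] using hp j

lemma hasDerivAt_toLp_update {d : ℕ} (p : Fin d → ℝ) (i : Fin d) (y : ℝ) :
    HasDerivAt (fun y => (WithLp.toLp 2 (Function.update p i y) : EuclideanSpace ℝ (Fin d)))
      (EuclideanSpace.single i 1) y := by
  have h := (hasDerivAt_update p i y)
  have h2 := ((EuclideanSpace.equiv (Fin d) ℝ).symm.hasFDerivAt
    (x := Function.update p i y)).comp_hasDerivAt y h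
  exact h2

/-- Differentiating an iterated partial derivative along a coordinate line. -/
lemma hasDerivWithinAt_iteratedFDerivWithin_update {d : ℕ} {a : EuclideanSpace ℝ (Fin d)}
    {g : EuclideanSpace ℝ (Fin d) → ℝ} (hg : ContDiffOn ℝ ∞ g (cube a 1)) {p : Fin d → ℝ}
    (hp : WithLp.toLp 2 p ∈ cube a 1) (n : ℕ) (v : Fin n → EuclideanSpace ℝ (Fin d)) (i : Fin d)
    {y : ℝ} (hy : y ∈ Set.Icc (a i) (a i + 1)) :
    HasDerivWithinAt
      (fun y => iteratedFDerivWithin ℝ n g (cube a 1) (WithLp.toLp 2 (Function.update p i y)) v)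
      (iteratedFDerivWithin ℝ (n + 1) g (cube a 1) (WithLp.toLp 2 (Function.update p i y))
        (Fin.cons (EuclideanSpace.single i 1) v)) (Set.Icc (a i) (a i + 1)) y := by
  have hQ := uniqueDiffOn_cube a one_pos
  have h1 := (hg.differentiableOn_iteratedFDerivWithin (m := n)
    (by exact_mod_cast WithTop.coe_lt_top (n : ℕ)) hQ _
    (update_mem_cube hp hy)).hasFDerivWithinAt
  have h2 := h1.comp_hasDerivWithinAt (s := Set.Icc (a i) (a i + 1)) y
    (hasDerivAt_toLp_update p i y).hasDerivWithinAt fun z hz => update_mem_cube hp hz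
  have h3 := (ContinuousMultilinearMap.apply ℝ (fun _ : Fin n => EuclideanSpace ℝ (Fin d)) ℝ v
    ).hasFDerivAt.comp_hasDerivWithinAt y h2
  refine h3.congr_deriv ?_
  rw [iteratedFDerivWithin_succ_apply_left]
  simp

/-- Coordinatewise propagation of smallness for a quasi-analytic class on a unit cube. -/
lemma exists_remez_lmarginal {M : ℕ → ℝ} (hM : ∀ n, 0 < M n)
    (hconv : ∀ n, M (n + 1) ^ 2 ≤ M n * M (n + 2)) (hdiv : ¬ Summable fun n => M n / M (n + 1))
    {d : ℕ} (S : Finset (Fin d)) : ∀ {s t : ℝ}, 0 < s → 0 < t →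
    ∃ ε > 0, ∀ (a : EuclideanSpace ℝ (Fin d)) (g : EuclideanSpace ℝ (Fin d) → ℝ),
      MemClass (fun n => ENNReal.ofReal (M n)) (cube a 1) g →
      ∀ E : Set (Fin d → ℝ), MeasurableSet E →
      (∀ p ∈ E, WithLp.toLp 2 p ∈ cube a 1 → |g (WithLp.toLp 2 p)| ≤ ε) →
      ∀ p : Fin d → ℝ, WithLp.toLp 2 p ∈ cube a 1 →
      ENNReal.ofReal s ≤ (∫⋯∫⁻_S, E.indicator 1
        ∂fun i => (volume : Measure ℝ).restrict (Set.Icc (a i) (a i + 1))) p →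
      |g (WithLp.toLp 2 p)| ≤ t := by
  classical
  induction S using Finset.induction_on with
  | empty =>
    intro s t hs ht
    refine ⟨t, ht, fun a g _ E _ hE p hp hsE => hE p ?_ hp⟩
    by_contra hpE
    rw [lmarginal_empty, Set.indicator_of_notMem hpE] at hsE
    exact hsE.not_gt (ENNReal.ofReal_pos.2 hs)
  | insert i S hi ih =>
    intro s t hs ht
    -- The constants are again chosen backwards: ε₁ is the smallness needed on a line in direction
    -- i, and the induction hypothesis for `S` must deliver it.
    obtain ⟨ε₁, hε₁, H₁⟩ := exists_remez_interval hM hconv hdiv (half_pos hs) ht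
    obtain ⟨ε₂, hε₂, H₂⟩ := ih (half_pos hs) hε₁
    refine ⟨ε₂, hε₂, fun a g hg E hEm hE p hp hsE => ?_⟩
    set μ : Fin d → Measure ℝ := fun i => volume.restrict (Set.Icc (a i) (a i + 1)) with hμ
    have : ∀ i, IsProbabilityMeasure (μ i) := fun i => ⟨by simp [hμ]⟩
    have hmeas : Measurable (E.indicator 1 : (Fin d → ℝ) → ℝ≥0∞) :=
      measurable_one.indicator hEm
    set φ : ℝ → ℝ≥0∞ := fun y => (∫⋯∫⁻_S, E.indicator 1 ∂μ) (Function.update p i y) with hφ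
    have hφm : Measurable φ := (hmeas.lmarginal μ).comp (measurable_update p)
    have hφ1 : ∀ y, φ y ≤ 1 := fun y => by
      calc φ y ≤ (∫⋯∫⁻_S, (fun _ => 1) ∂μ) (Function.update p i y) :=
            lmarginal_mono (Set.indicator_le_self' fun _ _ => zero_le) _
        _ ≤ 1 := by simp [lmarginal]
    rw [lmarginal_insert _ hmeas hi] at hsE
    change ENNReal.ofReal s ≤ ∫⁻ y, φ y ∂(μ i) at hsE
    -- `F` collects the positions on the line in direction i whose `S`-slice of `E` has measure at
    -- least s/2. Slices have measure at most 1, so an integral of at least s forces |F| ≥ s/2.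
    set F : Set ℝ := {y | ENNReal.ofReal (s / 2) ≤ φ y} ∩ Set.Icc (a i) (a i + 1) with hF
    have hFm : MeasurableSet {y | ENNReal.ofReal (s / 2) ≤ φ y} := hφm measurableSet_Ici
    have hFvol : ENNReal.ofReal (s / 2) ≤ volume F := by
      have h1 : ∫⁻ y, φ y ∂(μ i) ≤ volume F + ENNReal.ofReal (s / 2) := by
        calc ∫⁻ y, φ y ∂(μ i) ≤ ∫⁻ y, ({y | ENNReal.ofReal (s / 2) ≤ φ y}.indicator 1 y +
              ENNReal.ofReal (s / 2)) ∂(μ i) := by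
              refine lintegral_mono fun y => ?_
              by_cases hy : ENNReal.ofReal (s / 2) ≤ φ y
              · rw [Set.indicator_of_mem (by exact hy)]
                exact (hφ1 y).trans le_self_add
              · exact (not_le.1 hy).le.trans le_add_self
          _ = _ := by
            rw [lintegral_add_right _ measurable_const, lintegral_indicator_one hFm]
            simp [hμ, hF, Measure.restrict_apply hFm]
      have h2 := hsE.trans h1
      rw [← add_halves s, ENNReal.ofReal_add (by positivity) (by positivity), add_halves s] at h2
      exact (ENNReal.add_le_add_iff_right ENNReal.ofReal_ne_top).1 h2
    have hpi : p i ∈ Set.Icc (a i) (a i + 1) := toLp_mem_cube.1 hp i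
    have key := H₁ (a i) (fun n y => iteratedFDerivWithin ℝ n g (cube a 1)
      (WithLp.toLp 2 (Function.update p i y)) fun _ => EuclideanSpace.single i 1) F ?_ ?_
      Set.inter_subset_right hFvol ?_ (p i) hpi
    · simpa using key
    · intro n y hy
      have := hasDerivWithinAt_iteratedFDerivWithin_update hg.1 hp n
        (fun _ => EuclideanSpace.single i 1) i hy
      refine this.congr_deriv ?_
      congr 1
      funext j
      refine Fin.cases ?_ (fun j => ?_) j <;> simp
    · intro n y hy
      have := hg.2 n (fun _ => i) _ (update_mem_cube hp hy)
      rw [Real.enorm_eq_ofReal_abs, ENNReal.ofReal_le_ofReal_iff (hM n).le] at this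
      exact this
    · intro y hy
      have := H₂ a g hg E hEm hE (Function.update p i y) (update_mem_cube hp hy.2) hy.1
      simpa using this

/-- The Remez constant of a quasi-analytic class is finite. -/
lemma remezConst_lt_top {M : ℕ → ℝ} (hM : ∀ n, 0 < M n)
    (hconv : ∀ n, M (n + 1) ^ 2 ≤ M n * M (n + 2)) (hdiv : ¬ Summable fun n => M n / M (n + 1))
    {d : ℕ} {s t : ℝ≥0∞} (hs : s ≠ 0) (ht : t ≠ 0) :
    remezConst (fun n => ENNReal.ofReal (M n)) d t s < ⊤ := by
  obtain ⟨s', hs', hs's⟩ : ∃ s' : ℝ, 0 < s' ∧ ENNReal.ofReal s' ≤ s := by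
    obtain ⟨r, hr, hrs⟩ := ENNReal.lt_iff_exists_nnreal_btwn.1 (pos_iff_ne_zero.2 hs)
    exact ⟨r, by simpa using hr, by simpa using hrs.le⟩
  obtain ⟨t', ht', ht't⟩ : ∃ t' : ℝ, 0 < t' ∧ ENNReal.ofReal t' < t := by
    obtain ⟨r, hr, hrs⟩ := ENNReal.lt_iff_exists_nnreal_btwn.1 (pos_iff_ne_zero.2 ht)
    exact ⟨r, by simpa using hr, by simpa using hrs⟩
  obtain ⟨ε, hε, H⟩ := exists_remez_lmarginal hM hconv hdiv (Finset.univ : Finset (Fin d)) hs' ht'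
  have hbound : ∀ (a : EuclideanSpace ℝ (Fin d)) (g : EuclideanSpace ℝ (Fin d) → ℝ) (c : ℝ),
      (∀ x ∈ cube a 1, |g x| ≤ c) →
      eLpNorm g ∞ (volume.restrict (cube a 1)) ≤ ENNReal.ofReal c := fun a g c hc => by
    rw [eLpNorm_exponent_top]
    refine eLpNormEssSup_le_of_ae_bound ?_
    filter_upwards [ae_restrict_mem (isClosed_cube a 1).measurableSet] with x hx using hc x hx
  -- Every member of the class is bounded by M 0, so a lower bound ε for its norm on E makes M 0 / ε
  -- an admissible constant.
  refine lt_of_le_of_lt (sInf_le ?_) (ENNReal.ofReal_lt_top (r := M 0 / ε))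
  intro a g E hg htg hEm hEQ hsE
  have hle : ENNReal.ofReal ε ≤ eLpNorm g ∞ (volume.restrict E) := by
    by_contra hlt
    rw [not_le] at hlt
    refine (ht't.trans_le htg).not_ge (hbound a g t' fun x hx => ?_)
    have hae : ∀ᵐ x ∂volume.restrict E, |g x| ≤ ε := by
      rw [eLpNorm_exponent_top] at hlt
      filter_upwards [ae_le_eLpNormEssSup (f := g) (μ := volume.restrict E)] with x hx
      have := hx.trans hlt.le
      rwa [Real.enorm_eq_ofReal_abs, ENNReal.ofReal_le_ofReal_iff hε.le] at this
    -- g is continuous only on the cube, so measurability is obtained inside it.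
    have hGm : MeasurableSet ({x | |g x| ≤ ε} ∩ E) := by
      have h1 : MeasurableSet (cube a 1 ∩ g ⁻¹' Set.Icc (-ε) ε) :=
        (hg.1.continuousOn.preimage_isClosed_of_isClosed (isClosed_cube a 1)
          isClosed_Icc).measurableSet
      convert h1.inter hEm using 1
      ext x
      simp only [Set.mem_inter_iff, Set.mem_ofPred_eq, Set.mem_preimage, Set.mem_Icc, abs_le]
      exact ⟨fun h => ⟨⟨hEQ h.2, h.1⟩, h.2⟩, fun h => ⟨h.1.2, h.2⟩⟩
    have hvolG : volume ({x | |g x| ≤ ε} ∩ E) = volume E := by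
      refine le_antisymm (measure_mono Set.inter_subset_right) ?_
      rw [ae_restrict_iff' hEm] at hae
      refine measure_mono_ae ?_
      filter_upwards [hae] with x hx hxE using ⟨hx hxE, hxE⟩
    set e := MeasurableEquiv.toLp 2 (Fin d → ℝ) with he
    have hpres : MeasurePreserving e := EuclideanSpace.volume_preserving_symm_measurableEquiv_toLp _
      |>.symm
    have := H a g hg (e ⁻¹' ({x | |g x| ≤ ε} ∩ E)) (e.measurable hGm) (fun p hp _ => hp.1)
      (WithLp.ofLp x) hx ?_
    · exact this
    · rw [lmarginal_univ, lintegral_indicator_one (e.measurable hGm), ← Measure.restrict_pi_pi]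
      rw [Measure.restrict_apply (e.measurable hGm), Set.inter_eq_left.2]
      · rw [← volume_pi, hpres.measure_preimage hGm.nullMeasurableSet, hvolG]
        exact hs's.trans hsE
      · intro p hp i _
        exact hEQ hp.2 i
  calc eLpNorm g ∞ (volume.restrict (cube a 1)) ≤ ENNReal.ofReal (M 0) := by
        refine hbound a g _ fun x hx => ?_
        have := hg.2 0 Fin.elim0 x hx
        rwa [iteratedFDerivWithin_zero_apply, Real.enorm_eq_ofReal_abs,
          ENNReal.ofReal_le_ofReal_iff (hM 0).le] at this
    _ = ENNReal.ofReal (M 0 / ε) * ENNReal.ofReal ε := by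
      rw [← ENNReal.ofReal_mul (div_pos (hM 0) hε).le, div_mul_cancel₀ _ hε.ne']
    _ ≤ _ := by gcongr

/-! ### From the logarithmic integral to the Denjoy–Carleman condition -/

/-- `ENNReal.ofReal` truncates log to log⁺, so only t > 1/r contributes. There -(log(tr) + 1)/t is
an antiderivative, rising from -r to 0. -/
lemma lintegral_log_div_sq_le {r : ℝ} (hr : 0 < r) :
    ∫⁻ t : ℝ in Set.Ioi 0, ENNReal.ofReal (Real.log (t * r)) / ENNReal.ofReal (t ^ 2) ≤
      ENNReal.ofReal r := by
  have hderiv : ∀ t ∈ Set.Ici r⁻¹, HasDerivAt (fun t => -(Real.log (t * r) + 1) / t)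
      (Real.log (t * r) / t ^ 2) t := by
    intro t ht
    have ht0 : 0 < t := (inv_pos.2 hr).trans_le ht
    have h1 : HasDerivAt (fun t => t * r) r t := by simpa using (hasDerivAt_id t).mul_const r
    have h2 := ((h1.log (by positivity)).add_const 1).neg.div (hasDerivAt_id t) ht0.ne'
    refine h2.congr_deriv ?_
    simp only [id, Pi.neg_apply]
    field_simp
    ring
  have hnn : ∀ t ∈ Set.Ioi r⁻¹, 0 ≤ Real.log (t * r) / t ^ 2 := fun t ht => by
    have : 1 ≤ t * r := by
      have := (Set.mem_Ioi.1 ht).le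
      rwa [inv_le_iff_one_le_mul₀ hr] at this
    exact div_nonneg (Real.log_nonneg this) (sq_nonneg t)
  have hlim : Tendsto (fun t => -(Real.log (t * r) + 1) / t) atTop (𝓝 0) := by
    have h1 : Tendsto (fun t : ℝ => Real.log t / t) atTop (𝓝 0) := by
      simpa using Real.tendsto_pow_log_div_mul_add_atTop 1 0 1 one_ne_zero
    have h2 : Tendsto (fun t : ℝ => -(Real.log t / t) - (Real.log r + 1) * t⁻¹) atTop (𝓝 0) := by
      simpa using h1.neg.sub (tendsto_inv_atTop_zero.const_mul (Real.log r + 1))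
    refine h2.congr' ?_
    filter_upwards [eventually_gt_atTop 0] with t ht
    rw [Real.log_mul ht.ne' hr.ne']
    field_simp
    ring
  have hint := integrableOn_Ioi_deriv_of_nonneg' hderiv hnn hlim
  have hval := integral_Ioi_of_hasDerivAt_of_nonneg' hderiv hnn hlim
  calc ∫⁻ t : ℝ in Set.Ioi 0, ENNReal.ofReal (Real.log (t * r)) / ENNReal.ofReal (t ^ 2)
      ≤ ∫⁻ t : ℝ in Set.Ioi r⁻¹, ENNReal.ofReal (Real.log (t * r)) / ENNReal.ofReal (t ^ 2) := by
        rw [← lintegral_indicator measurableSet_Ioi, ← lintegral_indicator measurableSet_Ioi]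
        refine lintegral_mono fun t => ?_
        by_cases ht : t ∈ Set.Ioi r⁻¹
        · rw [Set.indicator_of_mem ht, Set.indicator_of_mem (Set.mem_Ioi.2 ((inv_pos.2 hr).trans ht))]
        · rw [Set.indicator_of_notMem ht]
          by_cases ht0 : t ∈ Set.Ioi (0 : ℝ)
          · rw [Set.indicator_of_mem ht0, ENNReal.ofReal_of_nonpos, ENNReal.zero_div]
            have h1 : t ≤ r⁻¹ := not_lt.1 ht
            refine Real.log_nonpos (mul_nonneg (le_of_lt ht0) hr.le) ?_
            rwa [le_inv_comm₀ ht0 hr, ← one_div, le_div_iff₀ ht0, mul_comm] at h1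
          · rw [Set.indicator_of_notMem ht0]
    _ = ∫⁻ t : ℝ in Set.Ioi r⁻¹, ENNReal.ofReal (Real.log (t * r) / t ^ 2) := by
        refine setLIntegral_congr_fun measurableSet_Ioi fun t ht => ?_
        rw [ENNReal.ofReal_div_of_pos (pow_pos (lt_trans (inv_pos.2 hr) ht) 2)]
    _ = ENNReal.ofReal r := by
        rw [← ofReal_integral_eq_lintegral_ofReal hint
          ((ae_restrict_iff' measurableSet_Ioi).2 (ae_of_all _ hnn)), hval]
        congr 1
        rw [inv_mul_cancel₀ hr.ne', Real.log_one]
        simp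
    _ ≤ _ := le_rfl

lemma toENNReal_log_ofReal {u : ℝ} (hu : 0 < u) :
    (ENNReal.log (ENNReal.ofReal u)).toENNReal = ENNReal.ofReal (Real.log u) := by
  rw [ENNReal.log_ofReal_of_pos hu, EReal.toENNReal_of_ne_top (EReal.coe_ne_top _),
    EReal.toReal_coe]

namespace IsWeight

variable {W : ℝ≥0 → ℝ≥0∞}

lemma one_le (hW : IsWeight W) (t : ℝ≥0) : 1 ≤ W t := by
  rw [← hW.eq_one 0 zero_le_one]; exact hW.mono zero_le

lemma div_le_pow (hW : IsWeight W) (t : ℝ≥0) (n : ℕ) : (t : ℝ≥0∞) ^ n / W t ≤ (t : ℝ≥0∞) ^ n :=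
  ENNReal.div_le_of_le_mul (le_mul_of_one_le_right' (hW.one_le t))

lemma one_le_weightSeq (hW : IsWeight W) (n : ℕ) : 1 ≤ weightSeq W n := by
  refine le_iSup_of_le 1 ?_
  simp [hW.eq_one 1 le_rfl]

lemma weightSeq_zero (hW : IsWeight W) : weightSeq W 0 = 1 :=
  le_antisymm (iSup_le fun t => by simpa using hW.div_le_pow t 0) (hW.one_le_weightSeq 0)

lemma weightSeq_mono (hW : IsWeight W) : Monotone (weightSeq W) := by
  refine monotone_nat_of_le_succ fun n => iSup_le fun t => ?_
  rcases le_total t 1 with ht | ht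
  · refine ((hW.div_le_pow t n).trans ?_).trans (hW.one_le_weightSeq _)
    exact pow_le_one' (by exact_mod_cast ht) n
  · refine le_iSup_of_le t ?_
    gcongr
    · exact_mod_cast ht
    · omega

lemma weightSeq_sq_le (W : ℝ≥0 → ℝ≥0∞) (n : ℕ) :
    weightSeq W (n + 1) ^ 2 ≤ weightSeq W n * weightSeq W (n + 2) := by
  have h : weightSeq W (n + 1) ≤ (weightSeq W n * weightSeq W (n + 2)) ^ (2 : ℝ)⁻¹ := by
    refine iSup_le fun t => ?_
    rw [ENNReal.le_rpow_inv_iff (by norm_num)]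
    calc ((t : ℝ≥0∞) ^ (n + 1) / W t) ^ (2 : ℝ)
        = ((t : ℝ≥0∞) ^ n / W t) * ((t : ℝ≥0∞) ^ (n + 2) / W t) := by
          rw [ENNReal.rpow_ofNat]; simp only [div_eq_mul_inv]; ring
      _ ≤ _ := mul_le_mul' (le_iSup (fun t : ℝ≥0 => (t : ℝ≥0∞) ^ n / W t) t)
          (le_iSup (fun t : ℝ≥0 => (t : ℝ≥0∞) ^ (n + 2) / W t) t)
  rw [ENNReal.le_rpow_inv_iff (by norm_num)] at h
  simpa using h

lemma pow_le_mul (hW : IsWeight W) (t : ℝ≥0) (n : ℕ) :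
    (t : ℝ≥0∞) ^ n ≤ weightSeq W n * W t := by
  have h := le_iSup (fun t : ℝ≥0 => (t : ℝ≥0∞) ^ n / W t) t
  have h0 : W t ≠ 0 := (zero_lt_one.trans_le (hW.one_le t)).ne'
  by_cases hT : W t = ⊤
  · rw [hT, ENNReal.mul_top (zero_lt_one.trans_le (hW.one_le_weightSeq n)).ne']
    exact le_top
  · exact (ENNReal.div_le_iff h0 hT).1 h

/-- `log W` in the logarithmic variable. -/
noncomputable def logWeight (W : ℝ≥0 → ℝ≥0∞) (x : ℝ) : ℝ := Real.log (W (Real.exp x).toNNReal).toReal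

lemma eq_ofReal_exp (hW : IsWeight W) {x : ℝ} (hx : W (Real.exp x).toNNReal ≠ ⊤) :
    W (Real.exp x).toNNReal = ENNReal.ofReal (Real.exp (logWeight W x)) := by
  have h0 : W (Real.exp x).toNNReal ≠ 0 := (zero_lt_one.trans_le (hW.one_le _)).ne'
  rw [logWeight, Real.exp_log (ENNReal.toReal_pos h0 hx), ENNReal.ofReal_toReal hx]

lemma log_eq_logWeight (hW : IsWeight W) {x : ℝ} (hx : W (Real.exp x).toNNReal ≠ ⊤) :
    ENNReal.log (W (Real.exp x).toNNReal) = logWeight W x := by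
  have h0 : W (Real.exp x).toNNReal ≠ 0 := (zero_lt_one.trans_le (hW.one_le _)).ne'
  rw [ENNReal.log_pos_real h0 hx, logWeight]

lemma logWeight_nonneg (hW : IsWeight W) (x : ℝ) : 0 ≤ logWeight W x := by
  by_cases hx : W (Real.exp x).toNNReal = ⊤
  · simp [logWeight, hx]
  · refine Real.log_nonneg ?_
    rw [← ENNReal.toReal_one]
    exact ENNReal.toReal_mono hx (hW.one_le _)

lemma logWeight_zero (hW : IsWeight W) : logWeight W 0 = 0 := by
  simp [logWeight, hW.eq_one 1 le_rfl]

lemma ne_top_of_le (hW : IsWeight W) {x y : ℝ} (hxy : x ≤ y)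
    (hy : W (Real.exp y).toNNReal ≠ ⊤) : W (Real.exp x).toNNReal ≠ ⊤ :=
  ne_top_of_le_ne_top hy (hW.mono (Real.toNNReal_le_toNNReal (Real.exp_le_exp.2 hxy)))

lemma logWeight_convex (hW : IsWeight W) {x y z : ℝ} (hx : 0 ≤ x) (hxy : x ≤ y) (hyz : y < z)
    (hz : W (Real.exp z).toNNReal ≠ ⊤) :
    (z - x) * logWeight W y ≤ (z - y) * logWeight W x + (y - x) * logWeight W z := by
  have hxz : 0 < z - x := by linarith
  have h := hW.log_convex x z ((z - y) / (z - x)) ((y - x) / (z - x)) hx (by linarith)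
    (div_nonneg (by linarith) hxz.le) (div_nonneg (by linarith) hxz.le) (by field_simp; ring)
  rw [show (z - y) / (z - x) * x + (y - x) / (z - x) * z = y by field_simp; ring,
    hW.log_eq_logWeight hz, hW.log_eq_logWeight (hW.ne_top_of_le hyz.le hz),
    hW.log_eq_logWeight (hW.ne_top_of_le (hxy.trans hyz.le) hz)] at h
  have h' : logWeight W y ≤ (z - y) / (z - x) * logWeight W x + (y - x) / (z - x) * logWeight W z := by
    exact_mod_cast h
  rw [div_mul_eq_mul_div, div_mul_eq_mul_div, ← add_div, le_div_iff₀ hxz] at h'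
  linarith

lemma pow_div_eq (hW : IsWeight W) {x : ℝ} (hx : W (Real.exp x).toNNReal ≠ ⊤) (n : ℕ) :
    ((Real.exp x).toNNReal : ℝ≥0∞) ^ n / W (Real.exp x).toNNReal =
      ENNReal.ofReal (Real.exp (n * x - logWeight W x)) := by
  rw [hW.eq_ofReal_exp hx, Real.exp_sub, ENNReal.ofReal_div_of_pos (Real.exp_pos _),
    Real.exp_nat_mul, ENNReal.ofReal_pow (Real.exp_pos _).le]
  rfl

lemma exists_exp {t : ℝ≥0} (ht : 1 ≤ t) : ∃ x : ℝ, 0 ≤ x ∧ t = (Real.exp x).toNNReal := by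
  refine ⟨Real.log t, Real.log_nonneg (by exact_mod_cast ht), ?_⟩
  rw [Real.exp_log (by exact_mod_cast zero_lt_one.trans_le ht), Real.toNNReal_coe]

/-- If W exceeded t^n at some t ≥ 1, convexity from the value log W = 0 at t = 1 would keep W(s) ≥
s^n for all later s, and M_n would be finite. So M_n = ∞ forces W(t) ≤ t^n on [1, ∞), which makes
the logarithmic integral converge. -/
lemma weightSeq_lt_top (hW : IsWeight W) (hlog : logIntegral W = ⊤) (n : ℕ) :
    weightSeq W n < ⊤ := by
  by_contra htop
  rw [not_lt, top_le_iff] at htop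
  have claim : ∀ t : ℝ≥0, 1 ≤ t → W t ≤ (t : ℝ≥0∞) ^ n := by
    intro t ht
    by_contra hlt
    rw [not_le] at hlt
    refine (htop.symm ▸ (ENNReal.pow_lt_top ENNReal.coe_lt_top : (t : ℝ≥0∞) ^ n < ⊤)).not_ge ?_
    refine iSup_le fun s => ?_
    rcases le_or_gt s t with hst | hst
    · exact (hW.div_le_pow s n).trans (by gcongr)
    refine le_trans ?_ (one_le_pow₀ (by exact_mod_cast ht))
    refine ENNReal.div_le_of_le_mul ?_
    rw [one_mul]
    by_cases hsT : W s = ⊤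
    · rw [hsT]; exact le_top
    obtain ⟨x, hx, rfl⟩ := exists_exp ht
    obtain ⟨z, hz, rfl⟩ := exists_exp (ht.trans hst.le)
    have hxz : x < z := by
      rwa [Real.toNNReal_lt_toNNReal_iff (Real.exp_pos _), Real.exp_lt_exp] at hst
    have h := hW.logWeight_convex le_rfl hx hxz hsT
    rw [hW.logWeight_zero] at h
    have hxT := hW.ne_top_of_le hxz.le hsT
    have hpow : ∀ y : ℝ, ((Real.exp y).toNNReal : ℝ≥0∞) ^ n = ENNReal.ofReal (Real.exp (n * y)) := by
      intro y
      rw [Real.exp_nat_mul, ENNReal.ofReal_pow (Real.exp_pos _).le]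
      rfl
    rw [hpow, hW.eq_ofReal_exp hxT, ENNReal.ofReal_lt_ofReal_iff (Real.exp_pos _),
      Real.exp_lt_exp] at hlt
    rw [hpow, hW.eq_ofReal_exp hsT]
    refine ENNReal.ofReal_le_ofReal (Real.exp_le_exp.2 ?_)
    have hx0 : 0 < x := by
      refine hx.lt_of_ne ?_
      rintro rfl
      rw [hW.logWeight_zero] at hlt
      simp at hlt
    have : x * (n * z) ≤ x * logWeight W z := by nlinarith
    exact le_of_mul_le_mul_left this hx0
  refine hlog.not_lt ?_
  calc logIntegral W
      ≤ ∫⁻ t : ℝ in Set.Ioi 0, n * (ENNReal.ofReal (Real.log (t * 1)) / ENNReal.ofReal (t ^ 2)) := by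
        refine setLIntegral_mono' measurableSet_Ioi fun t ht => ?_
        rw [← mul_div_assoc]
        refine ENNReal.div_le_div ?_ (ENNReal.ofReal_le_ofReal (by linarith))
        rcases le_total t 1 with h1 | h1
        · rw [hW.eq_one _ (Real.toNNReal_le_one.2 h1)]; simp
        · have h2 := ENNReal.log_monotone (claim t.toNNReal (by simpa using h1))
          refine (EReal.toENNReal_le_toENNReal h2).trans (le_of_eq ?_)
          rw [show ((t.toNNReal : ℝ≥0∞)) ^ n = ENNReal.ofReal (t ^ n) from
            (ENNReal.ofReal_pow (le_of_lt ht) n).symm, toENNReal_log_ofReal (pow_pos ht n),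
            Real.log_pow, ENNReal.ofReal_mul (Nat.cast_nonneg n), ENNReal.ofReal_natCast, mul_one]
    _ = n * ∫⁻ t : ℝ in Set.Ioi 0, ENNReal.ofReal (Real.log (t * 1)) / ENNReal.ofReal (t ^ 2) :=
        lintegral_const_mul' _ _ (ENNReal.natCast_ne_top n)
    _ ≤ n * ENNReal.ofReal 1 := by gcongr; exact lintegral_log_div_sq_le one_pos
    _ < ⊤ := ENNReal.mul_lt_top (ENNReal.natCast_lt_top n) ENNReal.ofReal_lt_top

lemma toReal_weightSeq_pos (hW : IsWeight W) (hfin : ∀ n, weightSeq W n < ⊤) (n : ℕ) :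
    0 < (weightSeq W n).toReal :=
  ENNReal.toReal_pos (zero_lt_one.trans_le (hW.one_le_weightSeq n)).ne' (hfin n).ne

/-- At a point below which the weight is finite, `log W` is controlled by some `M_n`, where `n` is
the integer part of a slope of a supporting line. -/
lemma exists_weightSeq_le (hW : IsWeight W) {x y₀ : ℝ} (hx : 0 < x) (hxy : x < y₀)
    (hy₀ : W (Real.exp y₀).toNNReal ≠ ⊤) :
    ∃ n : ℕ, weightSeq W n ≤ ENNReal.ofReal (Real.exp ((n + 1) * x - logWeight W x)) := by
  -- `P n` says that the line of slope n through the graph at x stays below log W to the right of x.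
  -- It holds for n = 0 and fails for large n because of the finite value at y₀.
  set P : ℕ → Prop := fun n => ∀ y, x < y → W (Real.exp y).toNNReal ≠ ⊤ →
    n * (y - x) ≤ logWeight W y - logWeight W x with hP
  obtain ⟨n, hn, hn1⟩ : ∃ n, P n ∧ ¬ P (n + 1) := by
    by_contra! hcon
    have hall : ∀ n, P n := fun n => by
      induction n with
      | zero =>
        intro y hy hyT
        have h := hW.logWeight_convex le_rfl hx.le hy hyT
        rw [hW.logWeight_zero] at h
        have h0 := hW.logWeight_nonneg x
        have h1 := hW.logWeight_nonneg y
        rw [Nat.cast_zero, zero_mul, sub_nonneg]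
        have : y * logWeight W x ≤ y * logWeight W y := by nlinarith
        exact le_of_mul_le_mul_left this (hx.trans hy)
      | succ n ih => exact hcon n ih
    obtain ⟨n, hn⟩ := exists_nat_gt ((logWeight W y₀ - logWeight W x) / (y₀ - x))
    rw [div_lt_iff₀ (sub_pos.2 hxy)] at hn
    exact (hall n y₀ hxy hy₀).not_gt hn
  simp only [hP] at hn1
  push Not at hn1
  obtain ⟨y₁, hxy₁, hy₁, hlt⟩ := hn1
  push_cast at hlt
  have hxT := hW.ne_top_of_le hxy₁.le hy₁
  -- Some chord to the right of x has slope below n + 1, so by convexity every chord to the left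
  -- does too. The gap between n and n + 1 is the source of the additional x in the bound.
  have hleft : ∀ z, 0 ≤ z → z ≤ x → logWeight W x - logWeight W z ≤ (n + 1) * (x - z) := by
    intro z hz hzx
    have h := hW.logWeight_convex hz hzx hxy₁ hy₁
    have h2 : (y₁ - x) * (logWeight W x - logWeight W z) ≤
        (y₁ - x) * ((n + 1) * (x - z)) := by
      have := mul_le_mul_of_nonneg_left hlt.le (sub_nonneg.2 hzx)
      nlinarith
    exact le_of_mul_le_mul_left h2 (sub_pos.2 hxy₁)
  refine ⟨n, iSup_le fun s => ?_⟩
  rcases le_total s 1 with hs | hs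
  · refine ((hW.div_le_pow s n).trans (pow_le_one' (by exact_mod_cast hs) n)).trans ?_
    rw [ENNReal.one_le_ofReal, Real.one_le_exp_iff]
    have := hleft 0 le_rfl hx.le
    rw [hW.logWeight_zero] at this
    linarith
  · by_cases hsT : W s = ⊤
    · simp [hsT]
    obtain ⟨z, hz, rfl⟩ := exists_exp hs
    rw [hW.pow_div_eq hsT]
    refine ENNReal.ofReal_le_ofReal (Real.exp_le_exp.2 ?_)
    rcases le_or_gt z x with hzx | hzx
    · have := hleft z hz hzx
      nlinarith
    · have := hn z hzx hsT
      nlinarith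

/-- Since M_0 = 1, the quotient t^n / M_n telescopes into the product of t M_k / M_{k+1} over k < n.
-/
lemma log_pow_div_weightSeq (hW : IsWeight W) (hfin : ∀ n, weightSeq W n < ⊤) {t : ℝ} (ht : 0 < t)
    (n : ℕ) : n * Real.log t - Real.log (weightSeq W n).toReal = ∑ k ∈ Finset.range n,
      Real.log (t * ((weightSeq W k).toReal / (weightSeq W (k + 1)).toReal)) := by
  induction n with
  | zero => simp [hW.weightSeq_zero]
  | succ n ih =>
    have h0 := (hW.toReal_weightSeq_pos hfin n).ne'
    have h1 := (hW.toReal_weightSeq_pos hfin (n + 1)).ne'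
    rw [Finset.sum_range_succ, ← ih, Real.log_mul ht.ne' (div_ne_zero h0 h1), Real.log_div h0 h1]
    push_cast
    ring

lemma ofReal_log_pow_div_le (hW : IsWeight W) (hfin : ∀ n, weightSeq W n < ⊤) {t : ℝ} (ht : 0 < t)
    (n : ℕ) : ENNReal.ofReal (n * Real.log t - Real.log (weightSeq W n).toReal) ≤ ∑' k,
      ENNReal.ofReal (Real.log (t * ((weightSeq W k).toReal / (weightSeq W (k + 1)).toReal))) := by
  rw [hW.log_pow_div_weightSeq hfin ht]
  refine le_trans ?_ (ENNReal.sum_le_tsum (Finset.range n))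
  generalize Finset.range n = S
  induction S using Finset.induction_on with
  | empty => simp
  | insert i S hi ih =>
    rw [Finset.sum_insert hi, Finset.sum_insert hi]
    exact ENNReal.ofReal_add_le.trans (by gcongr)

/-- The supporting-line bound gives log W ≤ x + log(e^{nx} / M_n) for one n. Replacing the
telescoped logarithm by all positive parts removes the dependence on n. -/
lemma log_le_tsum_of_lt (hW : IsWeight W) (hfin : ∀ n, weightSeq W n < ⊤) {x y₀ : ℝ} (hx : 0 < x)
    (hxy : x < y₀) (hy₀ : W (Real.exp y₀).toNNReal ≠ ⊤) :
    (ENNReal.log (W (Real.exp x).toNNReal)).toENNReal ≤ ENNReal.ofReal x + ∑' k, ENNReal.ofReal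
      (Real.log (Real.exp x * ((weightSeq W k).toReal / (weightSeq W (k + 1)).toReal))) := by
  obtain ⟨n, hn⟩ := hW.exists_weightSeq_le hx hxy hy₀
  have h1 : Real.log (weightSeq W n).toReal ≤ (n + 1) * x - logWeight W x := by
    rw [Real.log_le_iff_le_exp (hW.toReal_weightSeq_pos hfin n)]
    exact ENNReal.toReal_le_of_le_ofReal (Real.exp_pos _).le hn
  have h2 := hW.ofReal_log_pow_div_le hfin (Real.exp_pos x) n
  rw [Real.log_exp] at h2
  rw [hW.eq_ofReal_exp (hW.ne_top_of_le hxy.le hy₀), toENNReal_log_ofReal (Real.exp_pos _),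
    Real.log_exp]
  calc ENNReal.ofReal (logWeight W x)
      ≤ ENNReal.ofReal (x + (n * x - Real.log (weightSeq W n).toReal)) :=
        ENNReal.ofReal_le_ofReal (by linarith)
    _ ≤ _ := ENNReal.ofReal_add_le.trans (by gcongr)

/-- Only t ≤ e^y contributes to M_n once W = ∞ at e^y, so M_n ≤ e^{ny} and e^{nx} / M_n is unbounded
in n. -/
lemma tsum_log_eq_top (hW : IsWeight W) (hfin : ∀ n, weightSeq W n < ⊤) {x y : ℝ}
    (hyx : y < x) (hy : W (Real.exp y).toNNReal = ⊤) :
    ∑' k, ENNReal.ofReal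
      (Real.log (Real.exp x * ((weightSeq W k).toReal / (weightSeq W (k + 1)).toReal))) = ⊤ := by
  have hy0 : 0 ≤ y := by
    by_contra hneg
    rw [hW.eq_one _ (by rw [Real.toNNReal_le_one, Real.exp_le_one_iff]; linarith)] at hy
    exact ENNReal.one_ne_top hy
  have hM : ∀ n : ℕ, Real.log (weightSeq W n).toReal ≤ n * y := by
    intro n
    rw [Real.log_le_iff_le_exp (hW.toReal_weightSeq_pos hfin n)]
    refine ENNReal.toReal_le_of_le_ofReal (Real.exp_pos _).le (iSup_le fun s => ?_)
    rw [Real.exp_nat_mul, ENNReal.ofReal_pow (Real.exp_pos _).le]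
    rcases le_or_gt s (Real.exp y).toNNReal with hs | hs
    · refine (hW.div_le_pow s n).trans ?_
      gcongr
      exact ENNReal.coe_le_coe.2 hs
    · have : W s = ⊤ := top_le_iff.1 (hy ▸ hW.mono hs.le)
      simp [this]
  refine ENNReal.eq_top_of_forall_nnreal_le fun c => ?_
  obtain ⟨n, hn⟩ := exists_nat_gt (c / (x - y))
  rw [div_lt_iff₀ (sub_pos.2 hyx)] at hn
  refine le_trans ?_ (hW.ofReal_log_pow_div_le hfin (Real.exp_pos x) n)
  rw [Real.log_exp, ← ENNReal.ofReal_coe_nnreal]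
  refine ENNReal.ofReal_le_ofReal ?_
  have := hM n
  linarith

/-- The logarithmic integral condition implies the Denjoy–Carleman condition. -/
lemma not_summable_weightSeq (hW : IsWeight W) (hlog : logIntegral W = ⊤) :
    ¬ Summable fun n => (weightSeq W n).toReal / (weightSeq W (n + 1)).toReal := by
  have hfin := hW.weightSeq_lt_top hlog
  intro hsum
  set r : ℕ → ℝ := fun n => (weightSeq W n).toReal / (weightSeq W (n + 1)).toReal with hr
  have hr0 : ∀ n, 0 < r n := fun n =>
    div_pos (hW.toReal_weightSeq_pos hfin n) (hW.toReal_weightSeq_pos hfin (n + 1))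
  -- `X` contains at most the one point at which W passes from finite values to ∞. Neither pointwise
  -- bound applies there, and it is a null set.
  set X : Set ℝ := {t | 1 < t ∧ (∀ t', t < t' → W t'.toNNReal = ⊤) ∧
    ∀ t', t' < t → W t'.toNNReal ≠ ⊤} with hX
  have hXsub : X.Subsingleton := by
    have : ∀ t ∈ X, ∀ t' ∈ X, ¬ t < t' := fun t ht t' ht' hlt =>
      ht'.2.2 ((t + t') / 2) (by linarith) (ht.2.1 _ (by linarith))
    exact fun t ht t' ht' => le_antisymm (not_lt.1 (this _ ht' _ ht)) (not_lt.1 (this _ ht _ ht'))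
  have hXae : ∀ᵐ t ∂volume.restrict (Set.Ioi (0 : ℝ)), t ∉ X :=
    ae_restrict_of_ae (measure_eq_zero_iff_ae_notMem.1 (hXsub.measure_zero volume))
  have hpt : ∀ t : ℝ, 0 < t → t ∉ X → (ENNReal.log (W t.toNNReal)).toENNReal ≤
      ENNReal.ofReal (Real.log (t * 1)) + ∑' k, ENNReal.ofReal (Real.log (t * r k)) := by
    intro t ht htX
    rcases le_or_gt t 1 with h1 | h1
    · rw [hW.eq_one _ (Real.toNNReal_le_one.2 h1)]; simp
    obtain ⟨x, rfl⟩ : ∃ x, t = Real.exp x := ⟨Real.log t, (Real.exp_log ht).symm⟩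
    rw [Real.one_lt_exp_iff] at h1
    rw [mul_one, Real.log_exp]
    by_cases hup : ∃ t', Real.exp x < t' ∧ W t'.toNNReal ≠ ⊤
    · obtain ⟨t', ht', hT⟩ := hup
      have h0 : 0 < t' := ht.trans ht'
      rw [← Real.exp_log h0] at ht' hT
      exact hW.log_le_tsum_of_lt hfin h1 (Real.exp_lt_exp.1 ht') hT
    · push Not at hup
      have hlow : ∃ t', t' < Real.exp x ∧ W t'.toNNReal = ⊤ := by
        by_contra! hcon
        exact htX ⟨Real.one_lt_exp_iff.2 h1, hup, hcon⟩
      obtain ⟨t', ht', hT⟩ := hlow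
      have h0 : 0 < t' := by
        by_contra hneg
        rw [hW.eq_one _ (by rw [Real.toNNReal_le_one]; linarith)] at hT
        exact ENNReal.one_ne_top hT
      rw [← Real.exp_log h0] at ht' hT
      have := hW.tsum_log_eq_top hfin (Real.exp_lt_exp.1 ht') hT
      rw [show (∑' k, ENNReal.ofReal (Real.log (Real.exp x * r k))) = ⊤ from this]
      simp
  have hmeas : ∀ c : ℝ, Measurable fun t : ℝ =>
      ENNReal.ofReal (Real.log (t * c)) / ENNReal.ofReal (t ^ 2) := fun c => by fun_prop
  refine hlog.not_lt ?_
  calc logIntegral W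
      ≤ ∫⁻ t : ℝ in Set.Ioi 0, (ENNReal.ofReal (Real.log (t * 1)) / ENNReal.ofReal (t ^ 2) +
          ∑' k, ENNReal.ofReal (Real.log (t * r k)) / ENNReal.ofReal (t ^ 2)) := by
        refine lintegral_mono_ae ?_
        filter_upwards [hXae, ae_restrict_mem measurableSet_Ioi] with t ht ht0
        simp only [div_eq_mul_inv]
        rw [ENNReal.tsum_mul_right, ← add_mul]
        gcongr
        · exact hpt t ht0 ht
        · linarith
    _ = (∫⁻ t : ℝ in Set.Ioi 0, ENNReal.ofReal (Real.log (t * 1)) / ENNReal.ofReal (t ^ 2)) +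
          ∑' k, ∫⁻ t : ℝ in Set.Ioi 0,
            ENNReal.ofReal (Real.log (t * r k)) / ENNReal.ofReal (t ^ 2) := by
        rw [lintegral_add_left (hmeas 1), lintegral_tsum fun k => (hmeas _).aemeasurable]
    _ ≤ ENNReal.ofReal 1 + ∑' k, ENNReal.ofReal (r k) := by
        gcongr
        · exact lintegral_log_div_sq_le one_pos
        · exact lintegral_log_div_sq_le (hr0 _)
    _ < ⊤ := by
        rw [← ENNReal.ofReal_tsum_of_nonneg (fun k => (hr0 k).le) hsum]
        exact ENNReal.add_lt_top.2 ⟨ENNReal.ofReal_lt_top, ENNReal.ofReal_lt_top⟩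

/-- The real-valued form of the modified sequence. -/
lemma modifiedSeq_eq (hW : IsWeight W) (hfin : ∀ n, weightSeq W n < ⊤) (A : ℝ≥0) (d : ℕ) :
    modifiedSeq (weightSeq W) A d = fun n => ENNReal.ofReal
      ((A : ℝ) ^ n * (weightSeq W (n + d)).toReal / (weightSeq W d).toReal) := by
  funext n
  have hd := hW.toReal_weightSeq_pos hfin d
  rw [ENNReal.ofReal_div_of_pos hd, ENNReal.ofReal_mul (by positivity),
    ENNReal.ofReal_toReal (hfin _).ne, ENNReal.ofReal_toReal (hfin _).ne,
    ENNReal.ofReal_pow A.coe_nonneg, ENNReal.ofReal_coe_nnreal, modifiedSeq]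
  split_ifs with h
  · subst h
    rw [pow_zero, one_mul, zero_add, ENNReal.div_self _ (hfin d).ne]
    exact (zero_lt_one.trans_le (hW.one_le_weightSeq d)).ne'
  · rfl

/-- Finiteness of the Remez constant for the modified sequence of a weight. -/
lemma remezConst_lt_top (hW : IsWeight W) (hlog : logIntegral W = ⊤) {A : ℝ≥0} (hA : 0 < A)
    (d : ℕ) {s t : ℝ≥0∞} (hs : s ≠ 0) (ht : t ≠ 0) :
    remezConst (modifiedSeq (weightSeq W) A d) d t s < ⊤ := by
  have hfin := hW.weightSeq_lt_top hlog
  have hpos := hW.toReal_weightSeq_pos hfin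
  have hA' : (0 : ℝ) < A := hA
  rw [hW.modifiedSeq_eq hfin]
  refine _root_.remezConst_lt_top (fun n => ?_) (fun n => ?_) (fun hsum => ?_) hs ht
  · have := hpos (n + d); have := hpos d
    positivity
  · have h := ENNReal.toReal_mono (ENNReal.mul_ne_top (hfin (n + d)).ne (hfin (n + d + 2)).ne)
      (weightSeq_sq_le W (n + d))
    rw [ENNReal.toReal_pow, ENNReal.toReal_mul] at h
    have hd := hpos d
    rw [div_pow, div_mul_div_comm, ← sq, div_le_div_iff_of_pos_right (by positivity),
      show n + 1 + d = n + d + 1 by omega, show n + 2 + d = n + d + 2 by omega]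
    calc _ = (A : ℝ) ^ (2 * n + 2) * (weightSeq W (n + d + 1)).toReal ^ 2 := by ring
      _ ≤ (A : ℝ) ^ (2 * n + 2) *
          ((weightSeq W (n + d)).toReal * (weightSeq W (n + d + 2)).toReal) := by gcongr
      _ = _ := by ring
  · refine hW.not_summable_weightSeq hlog ((summable_nat_add_iff d).1 ?_)
    refine (hsum.mul_left (A : ℝ)).congr fun n => ?_
    have h1 := (hpos d).ne'
    have h2 := (hpos (n + d + 1)).ne'
    rw [show n + 1 + d = n + d + 1 by omega]
    field_simp
    ring

end IsWeight

/-! ### The smooth representative and its derivatives -/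

section FourierLp

variable {V : Type*} [NormedAddCommGroup V] [InnerProductSpace ℝ V] [FiniteDimensional ℝ V]
  [MeasurableSpace V] [BorelSpace V]

/-- On `L¹ ∩ L²`, the `L²`-Fourier transform is given by the Fourier integral. -/
lemma fourier_ae_eq_of_integrable (G : Lp ℂ 2 (volume : Measure V)) (hG : Integrable G) :
    ⇑(𝓕 G : Lp ℂ 2 (volume : Measure V)) =ᵐ[volume] 𝓕 (⇑G : V → ℂ) := by
  refine ae_eq_of_integral_contDiff_smul_eq
    ((Lp.memLp (𝓕 G : Lp ℂ 2 (volume : Measure V))).locallyIntegrable one_le_two)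
    (VectorFourier.fourierIntegral_continuous Real.continuous_fourierChar
      (by exact continuous_inner) hG).locallyIntegrable fun φ hφ hφc => ?_
  have hc : HasCompactSupport (Complex.ofRealCLM ∘ φ) := hφc.comp_left rfl
  have hs : ContDiff ℝ ∞ (Complex.ofRealCLM ∘ φ) := by fun_prop
  set ψ := hc.toSchwartzMap hs with hψ
  -- Both transforms are tested against ψ: `h1` moves the L² transform onto ψ through tempered
  -- distributions, and `h2` does the same for the Fourier integral by Fubini.
  have h1 := congrArg (fun T => T ψ) (Lp.fourier_toTemperedDistribution_eq G)
  simp only [TemperedDistribution.fourier_apply, Lp.toTemperedDistribution_apply] at h1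
  have h2 := VectorFourier.integral_fourierIntegral_smul_eq_flip (μ := (volume : Measure V))
    (ν := volume) (L := innerₗ V) Real.continuous_fourierChar (by exact continuous_inner)
    ψ.integrable hG
  rw [flip_innerₗ] at h2
  have h3 : ∀ x, ψ x = (φ x : ℂ) := fun x => rfl
  calc ∫ x, φ x • (𝓕 G : Lp ℂ 2 (volume : Measure V)) x
      = ∫ x, ψ x • (𝓕 G : Lp ℂ 2 (volume : Measure V)) x := by simp [h3]
    _ = ∫ x, (𝓕 ψ) x • G x := h1.symm
    _ = ∫ x, ψ x • 𝓕 (⇑G : V → ℂ) x := h2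
    _ = _ := by simp [h3]

/-- On `L¹ ∩ L²`, the inverse `L²`-Fourier transform is given by the inverse Fourier integral. -/
lemma fourierInv_ae_eq_of_integrable (G : Lp ℂ 2 (volume : Measure V)) (hG : Integrable G) :
    ⇑(𝓕⁻ G : Lp ℂ 2 (volume : Measure V)) =ᵐ[volume] 𝓕⁻ (⇑G : V → ℂ) := by
  have hcont : Continuous fun p : V × V => (-innerₗ V) p.1 p.2 := by
    exact (continuous_inner (𝕜 := ℝ) (E := V)).neg
  refine ae_eq_of_integral_contDiff_smul_eq
    ((Lp.memLp (𝓕⁻ G : Lp ℂ 2 (volume : Measure V))).locallyIntegrable one_le_two)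
    (VectorFourier.fourierIntegral_continuous Real.continuous_fourierChar
      hcont hG).locallyIntegrable fun φ hφ hφc => ?_
  have hc : HasCompactSupport (Complex.ofRealCLM ∘ φ) := hφc.comp_left rfl
  have hs : ContDiff ℝ ∞ (Complex.ofRealCLM ∘ φ) := by fun_prop
  set ψ := hc.toSchwartzMap hs with hψ
  have h1 := congrArg (fun T => T ψ) (Lp.fourierInv_toTemperedDistribution_eq G)
  simp only [TemperedDistribution.fourierInv_apply, Lp.toTemperedDistribution_apply] at h1
  have h2 := VectorFourier.integral_fourierIntegral_smul_eq_flip (μ := (volume : Measure V))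
    (ν := volume) (L := -innerₗ V) Real.continuous_fourierChar hcont ψ.integrable hG
  have hflip : (-innerₗ V).flip = -innerₗ V := by
    ext x y; simp [real_inner_comm]
  rw [hflip] at h2
  have h3 : ∀ x, ψ x = (φ x : ℂ) := fun x => rfl
  calc ∫ x, φ x • (𝓕⁻ G : Lp ℂ 2 (volume : Measure V)) x
      = ∫ x, ψ x • (𝓕⁻ G : Lp ℂ 2 (volume : Measure V)) x := by simp [h3]
    _ = ∫ x, (𝓕⁻ ψ) x • G x := h1.symm
    _ = ∫ x, ψ x • 𝓕⁻ (⇑G : V → ℂ) x := by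
      rw [SchwartzMap.fourierInv_coe]; exact h2
    _ = _ := by simp [h3]

lemma lintegral_enorm_sq_eq {f : V → ℂ} :
    ∫⁻ x, ‖f x‖ₑ ^ 2 = eLpNorm f 2 volume ^ 2 := by
  rw [eLpNorm_eq_lintegral_rpow_enorm_toReal two_ne_zero ENNReal.ofNat_ne_top,
    ENNReal.toReal_ofNat, ← ENNReal.rpow_natCast, ← ENNReal.rpow_mul]
  simp

/-- Plancherel's theorem for the Fourier integral on `L¹ ∩ L²`. -/
lemma lintegral_enorm_fourier_sq {H : V → ℂ} (h1 : Integrable H) (h2 : MemLp H 2 volume) :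
    ∫⁻ x, ‖𝓕 H x‖ₑ ^ 2 = ∫⁻ x, ‖H x‖ₑ ^ 2 := by
  have hae := h2.coeFn_toLp
  have h3 := fourier_ae_eq_of_integrable (h2.toLp H) (h1.congr hae.symm)
  have h4 : 𝓕 (⇑(h2.toLp H) : V → ℂ) = 𝓕 H := by
    funext x
    rw [Real.fourier_eq, Real.fourier_eq]
    refine integral_congr_ae ?_
    filter_upwards [hae] with y hy
    rw [hy]
  rw [h4] at h3
  rw [lintegral_enorm_sq_eq, lintegral_enorm_sq_eq, ← eLpNorm_congr_ae h3, ← eLpNorm_congr_ae hae,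
    ← Lp.enorm_def, ← Lp.enorm_def]
  simp only [← ofReal_norm]
  rw [Lp.norm_fourier_eq]

/-- Cauchy–Schwarz against (1 + |ξ|)^{-k}, which is square-integrable because 2k exceeds the
dimension. The compensating factor (1 + |ξ|)^k expands binomially into moments already in L². -/
lemma integrable_norm_pow_mul {F : V → ℂ}
    (hF : ∀ n : ℕ, MemLp (fun ξ => ‖ξ‖ ^ n * ‖F ξ‖) 2 volume) (n : ℕ) :
    Integrable fun ξ => ‖ξ‖ ^ n * ‖F ξ‖ := by
  set k := Module.finrank ℝ V + 1 with hk
  have h1 : MemLp (fun ξ : V => ((1 + ‖ξ‖) ^ k)⁻¹) 2 volume := by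
    rw [memLp_two_iff_integrable_sq (by fun_prop)]
    have := integrable_one_add_norm (E := V) (μ := volume) (r := (2 * k : ℕ))
      (by push_cast [hk]; linarith [(Nat.cast_nonneg (Module.finrank ℝ V) : (0 : ℝ) ≤ _)])
    refine this.congr (ae_of_all _ fun ξ => ?_)
    change (1 + ‖ξ‖) ^ (-((2 * k : ℕ) : ℝ)) = (((1 + ‖ξ‖) ^ k)⁻¹) ^ 2
    rw [Real.rpow_neg (by positivity), Real.rpow_natCast, inv_pow, ← pow_mul, mul_comm]
  have h2 : MemLp (fun ξ : V => (1 + ‖ξ‖) ^ k * (‖ξ‖ ^ n * ‖F ξ‖)) 2 volume := by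
    have h3 : (fun ξ : V => (1 + ‖ξ‖) ^ k * (‖ξ‖ ^ n * ‖F ξ‖)) =
        fun ξ => ∑ j ∈ Finset.range (k + 1), (k.choose j : ℝ) * (‖ξ‖ ^ (n + j) * ‖F ξ‖) := by
      funext ξ
      rw [add_comm, add_pow, Finset.sum_mul]
      refine Finset.sum_congr rfl fun j _ => ?_
      rw [one_pow]; ring
    rw [h3]
    exact memLp_finsetSum _ fun j _ => (hF (n + j)).const_mul _
  refine (h1.integrable_mul h2).congr (ae_of_all _ fun ξ => ?_)
  have : (1 + ‖ξ‖) ^ k ≠ 0 := by positivity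
  simp [inv_mul_cancel_left₀ this]

/-- Differentiating along the directions v multiplies F by one factor -2πi⟨ξ, v_j⟩ for each j;
Plancherel then turns the L² norm of the derivative into a moment of F. -/
lemma lintegral_enorm_iteratedFDeriv_fourier_sq_le {F : V → ℂ} (hFm : AEStronglyMeasurable F)
    (hF : ∀ n : ℕ, MemLp (fun ξ => ‖ξ‖ ^ n * ‖F ξ‖) 2 volume) (n : ℕ) (v : Fin n → V)
    (hv : ∀ j, ‖v j‖ ≤ 1) :
    ∫⁻ x, ‖iteratedFDeriv ℝ n (𝓕 F) x v‖ₑ ^ 2 ≤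
      ENNReal.ofReal ((2 * Real.pi) ^ (2 * n)) * ∫⁻ ξ, (‖ξ‖ₑ ^ n * ‖F ξ‖ₑ) ^ 2 := by
  have hint := integrable_norm_pow_mul hF
  set H : V → ℂ := fun ξ => VectorFourier.fourierPowSMulRight (innerSL ℝ) F ξ n v with hH
  have hpow : ∀ ξ, ‖H ξ‖ ≤ (2 * Real.pi) ^ n * (‖ξ‖ ^ n * ‖F ξ‖) := by
    intro ξ
    rw [hH]
    simp only [VectorFourier.fourierPowSMulRight_apply]
    rw [norm_smul, norm_smul, norm_pow, norm_neg, norm_prod]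
    have h2 : ‖(2 * (Real.pi : ℂ) * Complex.I)‖ = 2 * Real.pi := by
      simp [abs_of_pos Real.pi_pos]
    rw [h2]
    gcongr
    calc ∏ j, ‖(innerSL ℝ) ξ (v j)‖ ≤ ∏ _j : Fin n, ‖ξ‖ := by
          refine Finset.prod_le_prod (fun _ _ => norm_nonneg _) fun j _ => ?_
          exact (norm_inner_le_norm ξ (v j)).trans
            (mul_le_of_le_one_right (norm_nonneg _) (hv j))
      _ = ‖ξ‖ ^ n := by simp
  have hHm : AEStronglyMeasurable H := by
    have := hFm.fourierPowSMulRight (innerSL ℝ) n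
    exact (ContinuousMultilinearMap.apply ℝ (fun _ : Fin n => V) ℂ v
      ).continuous.comp_aestronglyMeasurable this
  have hDF : ∀ x, iteratedFDeriv ℝ n (𝓕 F) x v = 𝓕 H x := by
    intro x
    rw [Real.iteratedFDeriv_fourier (N := ⊤) (fun n _ => hint n) hFm le_top]
    exact (Real.fourier_continuousMultilinearMap_apply
      (VectorFourier.integrable_fourierPowSMulRight (innerSL ℝ) (hint n) hFm))
  have hHint : Integrable H := ((hint n).const_mul _).mono' hHm (ae_of_all _ hpow)
  have hH2 : MemLp H 2 volume := ((hF n).const_mul ((2 * Real.pi) ^ n)).mono' hHm (ae_of_all _ hpow)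
  simp only [hDF]
  rw [lintegral_enorm_fourier_sq hHint hH2, ← lintegral_const_mul' _ _ ENNReal.ofReal_ne_top]
  refine lintegral_mono fun ξ => ?_
  calc ‖H ξ‖ₑ ^ 2 ≤ (ENNReal.ofReal ((2 * Real.pi) ^ n * (‖ξ‖ ^ n * ‖F ξ‖))) ^ 2 := by
        rw [← ofReal_norm]; gcongr; exact hpow ξ
    _ = _ := by
        rw [ENNReal.ofReal_mul (by positivity), ENNReal.ofReal_mul (by positivity),
          ENNReal.ofReal_pow (norm_nonneg _), ofReal_norm, ofReal_norm, mul_pow,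
          ← ENNReal.ofReal_pow (by positivity), ← pow_mul, mul_comm n 2]

end FourierLp

/-- A function whose Fourier transform is square-integrable against a weight has a smooth
representative, whose derivatives are controlled by the sequence of the weight. -/
lemma IsWeight.exists_contDiff_representative {W : ℝ≥0 → ℝ≥0∞} (hW : IsWeight W)
    (hfin : ∀ n, weightSeq W n < ⊤) {d : ℕ} {C : ℝ≥0}
    (f : Lp ℂ 2 (volume : Measure (EuclideanSpace ℝ (Fin d))))
    (hf : (∫⁻ ξ, (‖(𝓕 f : Lp ℂ 2 (volume : Measure (EuclideanSpace ℝ (Fin d)))) ξ‖ₑ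
      * W ‖ξ‖₊) ^ 2) ≤ C ^ 2 * ∫⁻ x, ‖f x‖ₑ ^ 2) :
    ∃ u : EuclideanSpace ℝ (Fin d) → ℂ, ContDiff ℝ ∞ u ∧ f =ᵐ[volume] u ∧
      ∀ (n : ℕ) (i : Fin n → Fin d),
        ∫⁻ x, ‖iteratedFDeriv ℝ n u x fun k => EuclideanSpace.single (i k) (1 : ℝ)‖ₑ ^ 2 ≤
          ENNReal.ofReal ((2 * Real.pi) ^ (2 * n)) *
            (weightSeq W n ^ 2 * (C ^ 2 * ∫⁻ x, ‖f x‖ₑ ^ 2)) := by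
  set G : Lp ℂ 2 (volume : Measure (EuclideanSpace ℝ (Fin d))) := 𝓕 f with hG
  have hffin : ∫⁻ x, ‖f x‖ₑ ^ 2 < ⊤ := by
    rw [lintegral_enorm_sq_eq]
    exact ENNReal.pow_lt_top (Lp.memLp f).2
  -- The pointwise inequality |ξ|^n ≤ M_n W(|ξ|) turns the weight into moments. The reflection
  -- appears because f is the inverse transform of G, that is, the direct transform of ξ ↦ G(-ξ).
  have hmom : ∀ n : ℕ, ∫⁻ ξ, (‖ξ‖ₑ ^ n * ‖G (-ξ)‖ₑ) ^ 2 ≤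
      weightSeq W n ^ 2 * (C ^ 2 * ∫⁻ x, ‖f x‖ₑ ^ 2) := by
    intro n
    calc ∫⁻ ξ, (‖ξ‖ₑ ^ n * ‖G (-ξ)‖ₑ) ^ 2
        = ∫⁻ ξ, (‖-ξ‖ₑ ^ n * ‖G (-ξ)‖ₑ) ^ 2 := by simp only [enorm_neg]
      _ = ∫⁻ ξ, (‖ξ‖ₑ ^ n * ‖G ξ‖ₑ) ^ 2 :=
        lintegral_neg_eq_self (fun ξ => (‖ξ‖ₑ ^ n * ‖G ξ‖ₑ) ^ 2)
      _ ≤ ∫⁻ ξ, weightSeq W n ^ 2 * (‖G ξ‖ₑ * W ‖ξ‖₊) ^ 2 := by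
        refine lintegral_mono fun ξ => ?_
        rw [← mul_pow]
        have h := hW.pow_le_mul ‖ξ‖₊ n
        refine pow_le_pow_left' ?_ 2
        calc ‖ξ‖ₑ ^ n * ‖G ξ‖ₑ ≤ weightSeq W n * W ‖ξ‖₊ * ‖G ξ‖ₑ := by gcongr; exact h
          _ = _ := by rw [mul_assoc, mul_comm (W _)]
      _ = weightSeq W n ^ 2 * ∫⁻ ξ, (‖G ξ‖ₑ * W ‖ξ‖₊) ^ 2 :=
        lintegral_const_mul' _ _ (ENNReal.pow_lt_top (hfin n)).ne
      _ ≤ _ := by gcongr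
  have hm : AEStronglyMeasurable (fun ξ => G (-ξ)) volume :=
    (Lp.aestronglyMeasurable G).comp_quasiMeasurePreserving
      (Measure.measurePreserving_neg volume).quasiMeasurePreserving
  have hmem : ∀ n : ℕ, MemLp (fun ξ => ‖ξ‖ ^ n * ‖G (-ξ)‖) 2 volume := by
    intro n
    refine ⟨(by fun_prop : Continuous fun ξ : EuclideanSpace ℝ (Fin d) => ‖ξ‖ ^ n
      ).aestronglyMeasurable.mul hm.norm, ?_⟩
    have h1 : ∫⁻ ξ, ‖((‖ξ‖ ^ n * ‖G (-ξ)‖ : ℝ) : ℂ)‖ₑ ^ 2 < ⊤ := by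
      refine lt_of_le_of_lt (le_trans (le_of_eq ?_) (hmom n)) ?_
      · refine lintegral_congr fun ξ => ?_
        rw [← ofReal_norm, Complex.norm_real, ofReal_norm, enorm_mul, enorm_pow, enorm_norm,
          enorm_norm]
      · exact ENNReal.mul_lt_top (ENNReal.pow_lt_top (hfin n))
          (ENNReal.mul_lt_top (ENNReal.pow_lt_top ENNReal.coe_lt_top) hffin)
    rw [lintegral_enorm_sq_eq, ENNReal.pow_lt_top_iff] at h1
    have h2 := h1.resolve_right two_ne_zero
    rwa [eLpNorm_congr_norm_ae (ae_of_all _ fun ξ => Complex.norm_real _)] at h2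
  have hint := integrable_norm_pow_mul hmem
  have hGint : Integrable G := by
    have h0 : Integrable fun ξ => G (-ξ) := by
      rw [← integrable_norm_iff hm]
      simpa using hint 0
    simpa using h0.comp_neg
  refine ⟨𝓕 fun ξ => G (-ξ), Real.contDiff_fourier fun n _ => hint n, ?_, fun n i => ?_⟩
  · have h := fourierInv_ae_eq_of_integrable G hGint
    rw [hG, fourierInv_fourier_eq, ← hG, Real.fourierInv_eq_fourier_comp_neg] at h
    exact h
  · refine (lintegral_enorm_iteratedFDeriv_fourier_sq_le hm hmem n _ fun k => ?_).trans ?_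
    · simp
    · gcongr
      exact hmom n

/-! ### A Sobolev inequality on unit cubes -/

section Sobolev

/-- The identity f(x) = f(y) + ∫_y^x f' is averaged over y in an interval of length one. -/
lemma enorm_le_lintegral_add_lintegral_deriv {f f' : ℝ → ℂ} (hf : ∀ y, HasDerivAt f (f' y) y)
    (hf' : Continuous f') {a x : ℝ} (hx : x ∈ Set.Icc a (a + 1)) :
    ‖f x‖ₑ ≤ (∫⁻ y in Set.Icc a (a + 1), ‖f y‖ₑ) + ∫⁻ y in Set.Icc a (a + 1), ‖f' y‖ₑ := by
  have key : ∀ y ∈ Set.Icc a (a + 1), ‖f x‖ₑ ≤ ‖f y‖ₑ + ∫⁻ z in Set.Icc a (a + 1), ‖f' z‖ₑ := by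
    intro y hy
    have h1 := intervalIntegral.integral_eq_sub_of_hasDerivAt (a := y) (b := x)
      (fun z _ => hf z) (hf'.intervalIntegrable _ _)
    have h2 : f x = f y + ∫ z in y..x, f' z := by rw [h1]; ring
    have h3 : ‖∫ z in y..x, f' z‖ₑ ≤ ∫⁻ z in Set.Icc a (a + 1), ‖f' z‖ₑ := by
      rw [← ofReal_norm, intervalIntegral.norm_integral_eq_norm_integral_uIoc, ofReal_norm]
      refine (enorm_integral_le_lintegral_enorm _).trans (lintegral_mono_set ?_)
      exact Set.uIoc_subset_uIcc.trans (Set.uIcc_subset_Icc hy hx)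
    calc ‖f x‖ₑ ≤ ‖f y‖ₑ + ‖∫ z in y..x, f' z‖ₑ := by rw [h2]; exact enorm_add_le _ _
      _ ≤ _ := by gcongr
  calc ‖f x‖ₑ = ∫⁻ _y in Set.Icc a (a + 1), ‖f x‖ₑ := by simp
    _ ≤ ∫⁻ y in Set.Icc a (a + 1), (‖f y‖ₑ + ∫⁻ z in Set.Icc a (a + 1), ‖f' z‖ₑ) :=
      setLIntegral_mono' measurableSet_Icc key
    _ = _ := by
      rw [lintegral_add_right _ measurable_const]
      simp

/-- A pointwise bound on a unit cube by the integrals of mixed derivatives. -/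
lemma enorm_le_of_lintegral_le {d : ℕ} {D : ∀ n, (Fin n → Fin d) → (Fin d → ℝ) → ℂ}
    (hcont : ∀ n i, Continuous (D n i))
    (hderiv : ∀ n i p j y, HasDerivAt (fun y => D n i (Function.update p j y))
      (D (n + 1) (Fin.cons j i) (Function.update p j y)) y)
    (a : Fin d → ℝ) {B : ℕ → ℝ≥0∞} (hB : Monotone B)
    (hD : ∀ n i, ∫⁻ p in Set.univ.pi fun i => Set.Icc (a i) (a i + 1), ‖D n i p‖ₑ ≤ B n)
    (n : ℕ) (i : Fin n → Fin d) {p : Fin d → ℝ}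
    (hp : p ∈ Set.univ.pi fun i => Set.Icc (a i) (a i + 1)) :
    ‖D n i p‖ₑ ≤ 2 ^ d * B (n + d) := by
  classical
  set Q : Set (Fin d → ℝ) := Set.univ.pi fun i => Set.Icc (a i) (a i + 1) with hQ
  have hQm : MeasurableSet Q := MeasurableSet.univ_pi fun i => measurableSet_Icc
  set μ : Fin d → Measure ℝ := fun i => volume.restrict (Set.Icc (a i) (a i + 1)) with hμ
  set F : ∀ n, (Fin n → Fin d) → (Fin d → ℝ) → ℝ≥0∞ := fun n i =>
    Q.indicator fun p => ‖D n i p‖ₑ with hF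
  have hFm : ∀ n i, Measurable (F n i) := fun n i =>
    (hcont n i).measurable.enorm.indicator hQm
  have hupd : ∀ p ∈ Q, ∀ j, ∀ y ∈ Set.Icc (a j) (a j + 1), Function.update p j y ∈ Q := by
    intro p hp j y hy k _
    by_cases h : k = j
    · subst h; simpa using hy
    · simpa [h] using hp k trivial
  have hstep : ∀ n i j p, F n i p ≤ ∫⁻ y, (F n i + F (n + 1) (Fin.cons j i))
      (Function.update p j y) ∂(μ j) := by
    intro n i j p
    by_cases hp : p ∈ Q
    · have h1 := enorm_le_lintegral_add_lintegral_deriv (hderiv n i p j)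
        ((hcont (n + 1) (Fin.cons j i)).comp (continuous_const.update j continuous_id))
        (hp j trivial)
      rw [Function.update_eq_self] at h1
      rw [hF]
      simp only [Set.indicator_of_mem hp]
      refine h1.trans (le_of_eq ?_)
      rw [← lintegral_add_left]
      · refine setLIntegral_congr_fun measurableSet_Icc fun y hy => ?_
        simp [Set.indicator_of_mem (hupd p hp j y hy)]
      · exact ((hcont n i).comp (continuous_const.update j continuous_id)).measurable.enorm
    · simp [hF, Set.indicator_of_notMem hp]
  -- Here k counts the coordinates not integrated out. Each freed coordinate costs a factor 2 and
  -- one derivative in its direction, until k = d and the bound is pointwise.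
  have main : ∀ k, ∀ S : Finset (Fin d), Sᶜ.card = k → ∀ n i p,
      (∫⋯∫⁻_S, F n i ∂μ) p ≤ 2 ^ k * B (n + k) := by
    intro k
    induction k with
    | zero =>
      intro S hS n i p
      obtain rfl : S = Finset.univ := by simpa using hS
      rw [lmarginal_univ, pow_zero, one_mul, add_zero, ← Measure.restrict_pi_pi, ← volume_pi]
      refine le_trans (lintegral_mono fun p => ?_) (hD n i)
      exact Set.indicator_le_self' (fun _ _ => zero_le) p
    | succ k ih =>
      intro S hS n i p
      obtain ⟨j, hj⟩ : Sᶜ.Nonempty := by rw [← Finset.card_pos]; omega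
      have hjS : j ∉ S := Finset.mem_compl.1 hj
      have hcard : (insert j S)ᶜ.card = k := by
        rw [Finset.compl_insert, Finset.card_erase_of_mem hj, hS]; rfl
      calc (∫⋯∫⁻_S, F n i ∂μ) p
          ≤ (∫⋯∫⁻_S, (fun p => ∫⁻ y, (F n i + F (n + 1) (Fin.cons j i))
              (Function.update p j y) ∂(μ j)) ∂μ) p :=
            lmarginal_mono (fun p => hstep n i j p) p
        _ = (∫⋯∫⁻_(insert j S), (F n i + F (n + 1) (Fin.cons j i)) ∂μ) p := by
            rw [lmarginal_insert' _ ((hFm _ _).add (hFm _ _)) hjS]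
        _ = (∫⋯∫⁻_(insert j S), F n i ∂μ) p +
              (∫⋯∫⁻_(insert j S), F (n + 1) (Fin.cons j i) ∂μ) p := by
            simp only [lmarginal, Pi.add_apply]
            rw [lintegral_add_left]
            exact (hFm n i).comp measurable_updateFinset
        _ ≤ 2 ^ k * B (n + k) + 2 ^ k * B (n + 1 + k) :=
            add_le_add (ih _ hcard n i p) (ih _ hcard (n + 1) _ p)
        _ ≤ 2 ^ k * B (n + (k + 1)) + 2 ^ k * B (n + (k + 1)) := by
            gcongr <;> exact hB (by omega)
        _ = _ := by ring
  have h := main d ∅ (by simp) n i p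
  rw [lmarginal_empty] at h
  simpa [hF, Set.indicator_of_mem hp] using h

end Sobolev

/-! ### Tools for the local estimate and the decomposition into cubes -/

/-- The infimum is itself admissible: a finite nonzero norm on E can be divided out before passing
to the infimum, and a zero norm makes every admissible constant give zero. -/
lemma remezConst_spec {M : ℕ → ℝ≥0∞} {d : ℕ} {t s : ℝ≥0∞} (hfin : remezConst M d t s < ⊤)
    {a : EuclideanSpace ℝ (Fin d)} {g : EuclideanSpace ℝ (Fin d) → ℝ}
    {E : Set (EuclideanSpace ℝ (Fin d))} (hg : MemClass M (cube a 1) g)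
    (ht : t ≤ eLpNorm g ∞ (volume.restrict (cube a 1))) (hE : MeasurableSet E) (hEQ : E ⊆ cube a 1)
    (hs : s ≤ volume E) (hgE : eLpNorm g ∞ (volume.restrict E) ≠ ⊤) :
    eLpNorm g ∞ (volume.restrict (cube a 1)) ≤
      remezConst M d t s * eLpNorm g ∞ (volume.restrict E) := by
  have hC : ∀ C, IsRemezConst M d t s C → eLpNorm g ∞ (volume.restrict (cube a 1)) ≤
      C * eLpNorm g ∞ (volume.restrict E) := fun C hC => hC a g E hg ht hE hEQ hs
  by_cases h0 : eLpNorm g ∞ (volume.restrict E) = 0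
  · obtain ⟨C, hCm, -⟩ := sInf_lt_iff.1 hfin
    have := hC C hCm
    rwa [h0, mul_zero] at this ⊢
  · rw [← ENNReal.div_le_iff h0 hgE]
    exact le_sInf fun C hCm => (ENNReal.div_le_iff h0 hgE).2 (hC C hCm)

lemma cube_subset_closure_interior {d : ℕ} (a : EuclideanSpace ℝ (Fin d)) {l : ℝ} (hl : 0 < l) :
    cube a l ⊆ closure (interior (cube a l)) := by
  set e := (EuclideanSpace.equiv (Fin d) ℝ).toHomeomorph with he
  have h : cube a l = e ⁻¹' (Set.univ.pi fun i => Set.Icc (a i) (a i + l)) := cube_eq_preimage a l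
  rw [h, ← e.preimage_interior, ← e.preimage_closure, interior_pi_set Set.finite_univ,
    closure_pi_set]
  refine Set.preimage_mono (Set.pi_mono fun i _ => ?_)
  rw [interior_Icc, closure_Ioo (by linarith)]

/-- The essential supremum of a continuous function on a cube dominates its values. -/
lemma enorm_le_eLpNorm_top_cube {d : ℕ} {a : EuclideanSpace ℝ (Fin d)} {l : ℝ} (hl : 0 < l)
    {g : EuclideanSpace ℝ (Fin d) → ℝ} (hg : Continuous g) {x : EuclideanSpace ℝ (Fin d)}
    (hx : x ∈ cube a l) : ‖g x‖ₑ ≤ eLpNorm g ∞ (volume.restrict (cube a l)) := by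
  by_contra hlt
  rw [not_le] at hlt
  set β := eLpNorm g ∞ (volume.restrict (cube a l)) with hβ
  have hU : IsOpen {y | β < ‖g y‖ₑ} := isOpen_lt continuous_const hg.enorm
  have hne : ({y | β < ‖g y‖ₑ} ∩ interior (cube a l)).Nonempty :=
    mem_closure_iff.1 (cube_subset_closure_interior a hl hx) _ hU hlt
  have hpos := (hU.inter isOpen_interior).measure_pos volume hne
  have hae := ae_le_eLpNormEssSup (f := g) (μ := volume.restrict (cube a l))
  rw [ae_restrict_iff' (isClosed_cube a l).measurableSet] at hae
  refine hpos.ne' (measure_mono_null ?_ (ae_iff.1 hae))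
  rintro y ⟨hy1, hy2⟩ hcon
  have := hcon (interior_subset hy2)
  rw [hβ, eLpNorm_exponent_top] at hy1
  exact (not_le.2 hy1) this

lemma measurePreserving_toLp (d : ℕ) :
    MeasurePreserving (MeasurableEquiv.toLp 2 (Fin d → ℝ)) volume volume :=
  (EuclideanSpace.volume_preserving_symm_measurableEquiv_toLp _).symm

lemma toLp_preimage_cube {d : ℕ} (a : EuclideanSpace ℝ (Fin d)) (l : ℝ) :
    (MeasurableEquiv.toLp 2 (Fin d → ℝ)) ⁻¹' (cube a l) =
      Set.univ.pi fun i => Set.Icc (a i) (a i + l) := by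
  ext p
  exact ⟨fun h i _ => h i, fun h i => h i trivial⟩

lemma volume_cube {d : ℕ} (a : EuclideanSpace ℝ (Fin d)) : volume (cube a 1) = 1 := by
  rw [← (measurePreserving_toLp d).measure_preimage
    (isClosed_cube a 1).measurableSet.nullMeasurableSet, toLp_preimage_cube, volume_pi_pi]
  simp

lemma hasDerivAt_iteratedFDeriv_update {d : ℕ} {u : EuclideanSpace ℝ (Fin d) → ℂ}
    (hu : ContDiff ℝ ∞ u) (n : ℕ) (i : Fin n → Fin d) (p : Fin d → ℝ) (j : Fin d) (y : ℝ) :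
    HasDerivAt (fun y => iteratedFDeriv ℝ n u (WithLp.toLp 2 (Function.update p j y))
        fun k => EuclideanSpace.single (i k) (1 : ℝ))
      (iteratedFDeriv ℝ (n + 1) u (WithLp.toLp 2 (Function.update p j y))
        fun k => EuclideanSpace.single ((Fin.cons j i : Fin (n + 1) → Fin d) k) (1 : ℝ)) y := by
  have h1 := (hu.differentiable_iteratedFDeriv (m := n)
    (by exact_mod_cast WithTop.coe_lt_top (n : ℕ))
    (WithLp.toLp 2 (Function.update p j y))).hasFDerivAt
  have h2 := h1.comp_hasDerivAt y (hasDerivAt_toLp_update p j y)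
  have h3 := (ContinuousMultilinearMap.apply ℝ (fun _ : Fin n => EuclideanSpace ℝ (Fin d)) ℂ
    fun k => EuclideanSpace.single (i k) (1 : ℝ)).hasFDerivAt.comp_hasDerivAt y h2
  refine h3.congr_deriv ?_
  rw [iteratedFDeriv_succ_apply_left]
  simp only [Fin.cons_zero, ContinuousMultilinearMap.apply_apply]
  rfl

/-- A pointwise bound for the derivatives of a smooth function on a cube on which the derivatives
are controlled in the mean-square sense. -/
lemma enorm_iteratedFDeriv_le_of_lintegral_le {d : ℕ} {u : EuclideanSpace ℝ (Fin d) → ℂ}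
    (hu : ContDiff ℝ ∞ u) (a : EuclideanSpace ℝ (Fin d)) {B : ℕ → ℝ≥0∞} (hB : Monotone B)
    (hD : ∀ (n : ℕ) (i : Fin n → Fin d), ∫⁻ x in cube a 1,
      ‖iteratedFDeriv ℝ n u x fun k => EuclideanSpace.single (i k) (1 : ℝ)‖ₑ ^ 2 ≤ B n ^ 2)
    (n : ℕ) (i : Fin n → Fin d) {x : EuclideanSpace ℝ (Fin d)} (hx : x ∈ cube a 1) :
    ‖iteratedFDeriv ℝ n u x fun k => EuclideanSpace.single (i k) (1 : ℝ)‖ₑ ≤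
      2 ^ d * B (n + d) := by
  have hc : ∀ (n : ℕ) (i : Fin n → Fin d), Continuous fun x =>
      iteratedFDeriv ℝ n u x fun k => EuclideanSpace.single (i k) (1 : ℝ) := fun n i =>
    (ContinuousMultilinearMap.apply ℝ (fun _ : Fin n => EuclideanSpace ℝ (Fin d)) ℂ
      fun k => EuclideanSpace.single (i k) (1 : ℝ)).continuous.comp
      (hu.continuous_iteratedFDeriv (by exact_mod_cast le_top))
  have := enorm_le_of_lintegral_le (D := fun n i p => iteratedFDeriv ℝ n u (WithLp.toLp 2 p)
    fun k => EuclideanSpace.single (i k) (1 : ℝ))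
    (fun n i => (hc n i).comp (PiLp.continuous_toLp 2 _))
    (fun n i p j y => hasDerivAt_iteratedFDeriv_update hu n i p j y) a hB ?_ n i
    (p := WithLp.ofLp x) (fun i _ => hx i)
  · simpa using this
  · intro n i
    have : IsProbabilityMeasure (volume.restrict (cube a 1)) :=
      ⟨by rw [Measure.restrict_apply_univ, volume_cube]⟩
    have h1 := (measurePreserving_toLp d).setLIntegral_comp_preimage
      (isClosed_cube a 1).measurableSet (hc n i).measurable.enorm
    rw [toLp_preimage_cube] at h1
    refine (le_of_eq h1).trans ?_
    -- The cube has measure one, so its L¹ norm is at most its L² norm.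
    have h2 := eLpNorm_le_eLpNorm_of_exponent_le (one_le_two : (1 : ℝ≥0∞) ≤ 2)
      (hc n i).aestronglyMeasurable (μ := volume.restrict (cube a 1))
    rw [eLpNorm_one_eq_lintegral_enorm] at h2
    refine h2.trans ?_
    have h3 := hD n i
    rwa [show ∫⁻ x in cube a 1, ‖iteratedFDeriv ℝ n u x
      fun k => EuclideanSpace.single (i k) (1 : ℝ)‖ₑ ^ 2 = eLpNorm (fun x => iteratedFDeriv ℝ n u x
      fun k => EuclideanSpace.single (i k) (1 : ℝ)) 2 (volume.restrict (cube a 1)) ^ 2 by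
      rw [eLpNorm_eq_lintegral_rpow_enorm_toReal two_ne_zero ENNReal.ofNat_ne_top,
        ENNReal.toReal_ofNat, ← ENNReal.rpow_natCast, ← ENNReal.rpow_mul]
      simp, ENNReal.pow_le_pow_left_iff two_ne_zero] at h3

/-- Integrals decompose over the unit cubes with integer corners. -/
lemma lintegral_eq_tsum_cube {d : ℕ} (h : EuclideanSpace ℝ (Fin d) → ℝ≥0∞) :
    ∫⁻ x, h x = ∑' k : Fin d → ℤ, ∫⁻ x in cube (WithLp.toLp 2 fun i => (k i : ℝ)) 1, h x := by
  -- Half-open cells give an exact partition; each lies in the closed cube with the same corner and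
  -- has the same measure 1.
  set P : (Fin d → ℤ) → Set (EuclideanSpace ℝ (Fin d)) := fun k => {x | ∀ i, ⌊x i⌋ = k i} with hP
  have hPpre : ∀ k, (MeasurableEquiv.toLp 2 (Fin d → ℝ)) ⁻¹' (P k) =
      Set.univ.pi fun i => Set.Ico (k i : ℝ) (k i + 1) := by
    intro k
    ext p
    simp only [hP, Set.mem_preimage, Set.mem_ofPred_eq, Set.mem_pi, Set.mem_univ, true_imp_iff,
      Set.mem_Ico, ← Int.floor_eq_iff]
    rfl
  have hPm : ∀ k, MeasurableSet (P k) := fun k => by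
    rw [← (MeasurableEquiv.toLp 2 (Fin d → ℝ)).measurableSet_preimage, hPpre]
    exact MeasurableSet.univ_pi fun i => measurableSet_Ico
  have hae : ∀ k, P k =ᵐ[volume] cube (WithLp.toLp 2 fun i => (k i : ℝ)) 1 := by
    intro k
    have hsub : P k ⊆ cube (WithLp.toLp 2 fun i => (k i : ℝ)) 1 := fun x hx i => by
      have := Int.floor_eq_iff.1 (hx i)
      exact ⟨this.1, this.2.le⟩
    refine ae_eq_of_subset_of_measure_ge hsub ?_ (hPm k).nullMeasurableSet ?_
    · rw [volume_cube, ← (measurePreserving_toLp d).measure_preimage (hPm k).nullMeasurableSet,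
        hPpre, volume_pi_pi]
      simp
    · rw [volume_cube]; exact ENNReal.one_ne_top
  have hU : ⋃ k, P k = Set.univ := by
    ext x
    simp only [Set.mem_iUnion, Set.mem_univ, iff_true]
    exact ⟨fun i => ⌊x i⌋, fun i => rfl⟩
  have hdisj : Pairwise (Function.onFun Disjoint P) := by
    intro k l hkl
    refine Set.disjoint_left.2 fun x hx hx' => hkl (funext fun i => ?_)
    rw [← hx i, ← hx' i]
  rw [← setLIntegral_univ, ← hU, lintegral_iUnion hPm hdisj]
  exact tsum_congr fun k => by rw [Measure.restrict_congr_set (hae k)]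

/-- A set on which a function is at most a multiple of its mean. -/
lemma measure_le_of_markov {α : Type*} [MeasurableSpace α] {μ : Measure α} {h : α → ℝ≥0∞}
    (hh : Measurable h) {S : Set α} {γ : ℝ≥0} (hγ : 0 < γ) (hS : (γ : ℝ≥0∞) ≤ μ S)
    (hfin : ∫⁻ x in S, h x ∂μ ≠ ⊤) :
    (γ / 2 : ℝ≥0∞) ≤ μ ({x | h x ≤ 2 / γ * ∫⁻ x in S, h x ∂μ} ∩ S) := by
  set I := ∫⁻ x in S, h x ∂μ with hI
  have hγ0 : (γ : ℝ≥0∞) ≠ 0 := by exact_mod_cast hγ.ne'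
  -- Markov's inequality at height 2I/γ. The case I = 0 is separate because the height then vanishes
  -- and cannot be cancelled.
  have hbad : (μ.restrict S) {x | 2 / γ * I < h x} ≤ γ / 2 := by
    by_cases hI0 : I = 0
    · have : h =ᵐ[μ.restrict S] 0 := (lintegral_eq_zero_iff hh).1 hI0
      refine le_of_eq_of_le ?_ zero_le
      rw [hI0, mul_zero]
      refine measure_mono_null (fun x hx => ?_) (ae_iff.1 this)
      exact ne_of_gt hx
    · have h1 := mul_meas_ge_le_lintegral (μ := μ.restrict S) hh (2 / γ * I)
      have h2 : 2 / γ * I ≠ 0 := mul_ne_zero (ENNReal.div_ne_zero.2 ⟨two_ne_zero, by simp⟩) hI0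
      have h3 : 2 / γ * I ≠ ⊤ := ENNReal.mul_ne_top (ENNReal.div_ne_top (by simp) hγ0) hfin
      calc (μ.restrict S) {x | 2 / γ * I < h x} ≤ (μ.restrict S) {x | 2 / γ * I ≤ h x} :=
            by
            refine measure_mono fun x hx => ?_
            rw [Set.mem_ofPred_eq] at hx ⊢
            exact hx.le
        _ ≤ γ / 2 := by
          rw [← ENNReal.mul_le_mul_iff_right h2 h3]
          refine h1.trans (le_of_eq ?_)
          rw [← hI, mul_right_comm, ENNReal.div_eq_inv_mul, ENNReal.div_eq_inv_mul]
          rw [show (γ : ℝ≥0∞)⁻¹ * 2 * (2⁻¹ * γ) * I = ((γ : ℝ≥0∞)⁻¹ * γ) * (2 * 2⁻¹) * I by ring,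
            ENNReal.inv_mul_cancel hγ0 (by simp), ENNReal.mul_inv_cancel (by simp) (by simp)]
          ring
  have hsplit : μ S ≤ μ ({x | h x ≤ 2 / γ * I} ∩ S) + γ / 2 := by
    have hm : MeasurableSet {x | h x ≤ 2 / γ * I} := hh measurableSet_Iic
    have hm' : MeasurableSet {x | 2 / γ * I < h x} := hh measurableSet_Ioi
    calc μ S ≤ μ (({x | h x ≤ 2 / γ * I} ∩ S) ∪ ({x | 2 / γ * I < h x} ∩ S)) :=
          measure_mono fun x hx => (le_or_gt (h x) (2 / γ * I)).imp (⟨·, hx⟩) (⟨·, hx⟩)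
      _ ≤ _ := (measure_union_le _ _).trans (by
        rw [← Measure.restrict_apply hm']; gcongr)
  have h4 := hS.trans hsplit
  rw [← ENNReal.add_halves (γ : ℝ≥0∞)] at h4
  refine (ENNReal.add_le_add_iff_right ?_).1 (h4.trans (by rw [ENNReal.add_halves]))
  exact ENNReal.div_ne_top (by simp) two_ne_zero

lemma modifiedSeq_eq_div {M : ℕ → ℝ≥0∞} {d : ℕ} (h0 : M d ≠ 0) (hT : M d ≠ ⊤) (A : ℝ≥0) (n : ℕ) :
    modifiedSeq M A d n = (A : ℝ≥0∞) ^ n * M (n + d) / M d := by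
  rw [modifiedSeq]
  split_ifs with h
  · subst h
    rw [pow_zero, one_mul, zero_add, ENNReal.div_self h0 hT]
  · rfl

/-! ### Good cubes -/

/-- The local estimate on a good cube. -/
lemma lintegral_cube_le_remezConst {M : ℕ → ℝ≥0∞} (hMmono : Monotone M) {d : ℕ} (hM0 : M d ≠ 0)
    (hMT : M d ≠ ⊤) {B C : ℝ≥0} (hB : 1 ≤ B) (hC : 0 < C) {γ : ℝ≥0} (hγ : 0 < γ)
    (hfin : remezConst (modifiedSeq M (2 * B) d) d
      (1 / (C * (2 * B : ℝ≥0) ^ (1 + d) * M d)) (γ / 2) < ⊤)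
    {u : EuclideanSpace ℝ (Fin d) → ℂ} (hu : ContDiff ℝ ∞ u) (a : EuclideanSpace ℝ (Fin d))
    (hgood : ∀ (n : ℕ) (i : Fin n → Fin d), ∫⁻ x in cube a 1,
      ‖iteratedFDeriv ℝ n u x fun k => EuclideanSpace.single (i k) (1 : ℝ)‖ₑ ^ 2 ≤
        (B ^ (n + 1) * M n * C) ^ 2 * ∫⁻ x in cube a 1, ‖u x‖ₑ ^ 2)
    {E : Set (EuclideanSpace ℝ (Fin d))} (hE : MeasurableSet E)
    (hEγ : (γ : ℝ≥0∞) ≤ volume (E ∩ cube a 1)) :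
    ∫⁻ x in cube a 1, ‖u x‖ₑ ^ 2 ≤ 2 / γ * remezConst (modifiedSeq M (2 * B) d) d
      (1 / (C * (2 * B : ℝ≥0) ^ (1 + d) * M d)) (γ / 2) ^ 2 *
        ∫⁻ x in E ∩ cube a 1, ‖u x‖ₑ ^ 2 := by
  set Q := cube a 1 with hQ
  set J := ∫⁻ x in Q, ‖u x‖ₑ ^ 2 with hJ
  set Θ := remezConst (modifiedSeq M (2 * B) d) d
      (1 / (C * (2 * B : ℝ≥0) ^ (1 + d) * M d)) (γ / 2) with hΘ
  have hQm : MeasurableSet Q := (isClosed_cube a 1).measurableSet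
  by_cases hJ0 : J = 0
  · rw [hJ0]; exact zero_le
  have hQc : IsCompact Q := by
    have : Q = (EuclideanSpace.equiv (Fin d) ℝ).toHomeomorph ⁻¹'
      (Set.univ.pi fun i => Set.Icc (a i) (a i + 1)) := cube_eq_preimage a 1
    rw [this, Homeomorph.isCompact_preimage]
    exact isCompact_univ_pi fun i => isCompact_Icc
  obtain ⟨x₀, hx₀, hmax⟩ := hQc.exists_isMaxOn ⟨a, fun i => ⟨le_rfl, by linarith⟩⟩
    hu.continuous.norm.continuousOn
  have hmax' : ∀ x ∈ Q, ‖u x‖ₑ ≤ ‖u x₀‖ₑ := fun x hx => by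
    rw [← ofReal_norm, ← ofReal_norm]
    exact ENNReal.ofReal_le_ofReal (hmax hx)
  have hJle : J ≤ ‖u x₀‖ₑ ^ 2 := by
    calc J ≤ ∫⁻ _x in Q, ‖u x₀‖ₑ ^ 2 := setLIntegral_mono' hQm fun x hx => by
          gcongr; exact hmax' x hx
      _ = ‖u x₀‖ₑ ^ 2 := by rw [setLIntegral_const, hQ, volume_cube, mul_one]
  have hJT : J ≠ ⊤ := ne_top_of_le_ne_top (ENNReal.pow_lt_top enorm_lt_top).ne hJle
  set K : ℝ≥0∞ := J ^ (2⁻¹ : ℝ) with hK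
  have hKsq : K ^ 2 = J := by
    rw [hK, ← ENNReal.rpow_natCast, ← ENNReal.rpow_mul]; simp
  have hK0 : K ≠ 0 := fun h => hJ0 (by rw [← hKsq, h]; simp)
  have hKT : K ≠ ⊤ := fun h => hJT (by rw [← hKsq, h]; simp)
  -- With A = 2B this is the normalisation for which the Sobolev bound 2^d B^{n+d+1} M_{n+d} C K is
  -- at most c · M̃_n: the factor A^{1+d} M_d makes up for the shift by d.
  set c : ℝ≥0∞ := C * (2 * B : ℝ≥0) ^ (1 + d) * M d * K with hc
  have hC0 : (C : ℝ≥0∞) ≠ 0 := by exact_mod_cast hC.ne'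
  have hA0 : ((2 * B : ℝ≥0) : ℝ≥0∞) ^ (1 + d) ≠ 0 := by
    have : (2 * B : ℝ≥0) ≠ 0 := by positivity
    exact pow_ne_zero _ (by exact_mod_cast this)
  have hAT : ((2 * B : ℝ≥0) : ℝ≥0∞) ^ (1 + d) ≠ ⊤ := (ENNReal.pow_lt_top ENNReal.coe_lt_top).ne
  have hc0 : c ≠ 0 := mul_ne_zero (mul_ne_zero (mul_ne_zero hC0 hA0) hM0) hK0
  have hcT : c ≠ ⊤ := ENNReal.mul_ne_top (ENNReal.mul_ne_top
    (ENNReal.mul_ne_top ENNReal.coe_ne_top hAT) hMT) hKT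
  have hptw : ∀ (n : ℕ) (i : Fin n → Fin d), ∀ x ∈ Q,
      ‖iteratedFDeriv ℝ n u x fun k => EuclideanSpace.single (i k) (1 : ℝ)‖ₑ ≤
        c * modifiedSeq M (2 * B) d n := by
    intro n i x hx
    refine (enorm_iteratedFDeriv_le_of_lintegral_le hu a
      (B := fun n => B ^ (n + 1) * M n * C * K) ?_ ?_ n i hx).trans ?_
    · intro m n hmn
      have hB' : (1 : ℝ≥0∞) ≤ B := by exact_mod_cast hB
      have h1 := hMmono hmn
      dsimp only
      gcongr
    · intro n i
      rw [mul_pow, hKsq]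
      exact hgood n i
    · rw [modifiedSeq_eq_div hM0 hMT, hc]
      calc (2 : ℝ≥0∞) ^ d * (B ^ (n + d + 1) * M (n + d) * C * K)
          ≤ 2 ^ (n + d + 1) * (B ^ (n + d + 1) * M (n + d) * C * K) := by
            gcongr
            · exact one_le_two
            · omega
        _ = (2 * B) ^ (n + d + 1) * (M (n + d) * C * K) := by rw [mul_pow]; ring
        _ = C * (2 * B) ^ (1 + d) * K * ((2 * B) ^ n * M (n + d)) := by ring
        _ = C * (2 * B) ^ (1 + d) * K * (M d * ((2 * B) ^ n * M (n + d) / M d)) := by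
            rw [ENNReal.mul_div_cancel hM0 hMT]
        _ = _ := by push_cast; ring
  -- The class consists of real functions. The unimodular w rotates u(x₀) onto the positive axis, so
  -- taking real parts loses nothing at the maximum of |u|.
  obtain ⟨w, hw, hwu⟩ := RCLike.exists_norm_eq_mul_self (u x₀)
  have hcr : 0 < c.toReal := ENNReal.toReal_pos hc0 hcT
  set L : ℂ →L[ℝ] ℝ := c.toReal⁻¹ • (Complex.reCLM ∘L
    ((ContinuousLinearMap.mul ℂ ℂ w).restrictScalars ℝ)) with hL
  have hLapp : ∀ z, L z = c.toReal⁻¹ * (w * z).re := fun z => rfl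
  have hLle : ∀ z, ‖L z‖ₑ ≤ c⁻¹ * ‖z‖ₑ := by
    intro z
    rw [hLapp, enorm_mul, Real.enorm_eq_ofReal (inv_nonneg.2 hcr.le),
      ENNReal.ofReal_inv_of_pos hcr, ENNReal.ofReal_toReal hcT]
    gcongr
    rw [← ofReal_norm, ← ofReal_norm]
    refine ENNReal.ofReal_le_ofReal ((Complex.abs_re_le_norm _).trans ?_)
    rw [norm_mul, hw, one_mul]
  have hLx₀ : ‖L (u x₀)‖ₑ = c⁻¹ * ‖u x₀‖ₑ := by
    rw [hLapp, ← hwu, enorm_mul, Real.enorm_eq_ofReal (inv_nonneg.2 hcr.le),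
      ENNReal.ofReal_inv_of_pos hcr, ENNReal.ofReal_toReal hcT]
    simp
  set g : EuclideanSpace ℝ (Fin d) → ℝ := L ∘ u with hg
  have hgs : ContDiff ℝ ∞ g := L.contDiff.comp hu
  have hgmem : MemClass (modifiedSeq M (2 * B) d) Q g := by
    refine ⟨hgs.contDiffOn, fun n i x hx => ?_⟩
    rw [iteratedFDerivWithin_eq_iteratedFDeriv (uniqueDiffOn_cube a one_pos)
      (hgs.contDiffAt.of_le (by exact_mod_cast le_top)) hx, hg,
      L.iteratedFDeriv_comp_left hu.contDiffAt (by exact_mod_cast le_top)]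
    refine (hLle _).trans ?_
    calc _ ≤ c⁻¹ * (c * modifiedSeq M (2 * B) d n) := by gcongr; exact hptw n i x hx
      _ = _ := by rw [← mul_assoc, ENNReal.inv_mul_cancel hc0 hcT, one_mul]
  have hgx₀ : c⁻¹ * ‖u x₀‖ₑ ≤ eLpNorm g ∞ (volume.restrict Q) := by
    rw [← hLx₀]
    exact enorm_le_eLpNorm_top_cube one_pos hgs.continuous hx₀
  -- On a cube of measure one the maximum of |u| is at least its L² norm K, and K / c is exactly the
  -- threshold.
  have ht : 1 / (C * (2 * B : ℝ≥0) ^ (1 + d) * M d) ≤ eLpNorm g ∞ (volume.restrict Q) := by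
    refine le_trans ?_ hgx₀
    have hKu : K ≤ ‖u x₀‖ₑ := by
      rw [← ENNReal.pow_le_pow_left_iff two_ne_zero, hKsq]; exact hJle
    calc 1 / (C * (2 * B : ℝ≥0) ^ (1 + d) * M d) = c⁻¹ * K := by
          rw [hc, ENNReal.mul_inv (Or.inr hKT) (Or.inr hK0), mul_assoc _ K⁻¹ K,
            ENNReal.inv_mul_cancel hK0 hKT, one_div, mul_one]
      _ ≤ _ := by gcongr
  set I := ∫⁻ x in E ∩ Q, ‖u x‖ₑ ^ 2 with hI
  have hIT : I ≠ ⊤ := ne_top_of_le_ne_top hJT (lintegral_mono_set Set.inter_subset_right)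
  have hum : Measurable fun x => ‖u x‖ₑ ^ 2 := hu.continuous.measurable.enorm.pow_const 2
  set E' := {x | ‖u x‖ₑ ^ 2 ≤ 2 / γ * I} ∩ (E ∩ Q) with hE'
  have hE'vol : (γ / 2 : ℝ≥0∞) ≤ volume E' := measure_le_of_markov hum hγ hEγ hIT
  have hE'm : MeasurableSet E' :=
    (hum measurableSet_Iic : MeasurableSet {x | ‖u x‖ₑ ^ 2 ≤ 2 / γ * I}).inter (hE.inter hQm)
  set q : ℝ≥0∞ := (2 / γ * I) ^ (2⁻¹ : ℝ) with hq
  have hqsq : q ^ 2 = 2 / γ * I := by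
    rw [hq, ← ENNReal.rpow_natCast, ← ENNReal.rpow_mul]; simp
  have hgE' : eLpNorm g ∞ (volume.restrict E') ≤ c⁻¹ * q := by
    rw [eLpNorm_exponent_top]
    refine essSup_le_of_ae_le _ ?_
    filter_upwards [ae_restrict_mem hE'm] with x hx
    refine (hLle (u x)).trans ?_
    gcongr
    rw [← ENNReal.pow_le_pow_left_iff two_ne_zero, hqsq]
    exact hx.1
  have hγ0 : (γ : ℝ≥0∞) ≠ 0 := by exact_mod_cast hγ.ne'
  have hqT : q ≠ ⊤ := ENNReal.rpow_ne_top_of_nonneg (by norm_num)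
    (ENNReal.mul_ne_top (ENNReal.div_ne_top (by simp) hγ0) hIT)
  have hrem := remezConst_spec hfin hgmem ht hE'm (fun x hx => hx.2.2) hE'vol
    (ne_top_of_le_ne_top (ENNReal.mul_ne_top (ENNReal.inv_ne_top.2 hc0) hqT) hgE')
  have hfinal : ‖u x₀‖ₑ ≤ Θ * q := by
    have h1 : c⁻¹ * ‖u x₀‖ₑ ≤ c⁻¹ * (Θ * q) := by
      refine hgx₀.trans (hrem.trans ?_)
      calc _ ≤ Θ * (c⁻¹ * q) := by gcongr
        _ = _ := by ring
    exact (ENNReal.mul_le_mul_iff_right (ENNReal.inv_ne_zero.2 hcT) (ENNReal.inv_ne_top.2 hc0)).1 h1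
  calc J ≤ (Θ * q) ^ 2 := hJle.trans (by gcongr)
    _ = 2 / γ * Θ ^ 2 * I := by rw [mul_pow, hqsq]; ring

/-! ### Bad cubes and the conclusion -/

/-- This fixes B = 32d. The left side is the Plancherel factor times the d^n choices of directions;
the weights 4⁻¹ 2⁻ⁿ on the right sum to 1/2, the share allowed to bad cubes. -/
lemma four_mul_pow_le {d : ℕ} (hd : 1 ≤ d) (n : ℕ) :
    ENNReal.ofReal ((2 * Real.pi) ^ (2 * n)) * (d : ℝ≥0∞) ^ n ≤
      4⁻¹ * 2⁻¹ ^ n * (((32 * d : ℝ≥0) : ℝ≥0∞) ^ (n + 1)) ^ 2 := by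
  have hd' : (1 : ℝ) ≤ d := by exact_mod_cast hd
  have hpi : (2 * Real.pi) ^ 2 * d ≤ 2⁻¹ * (32 * d) ^ 2 := by
    have h1 : Real.pi ^ 2 ≤ 16 := by nlinarith [Real.pi_le_four, Real.pi_pos]
    nlinarith
  have hreal : (2 * Real.pi) ^ (2 * n) * (d : ℝ) ^ n ≤
      4⁻¹ * 2⁻¹ ^ n * ((32 * (d : ℝ)) ^ (n + 1)) ^ 2 := by
    calc (2 * Real.pi) ^ (2 * n) * (d : ℝ) ^ n = ((2 * Real.pi) ^ 2 * d) ^ n := by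
          rw [mul_pow _ (d : ℝ), ← pow_mul]
      _ ≤ (2⁻¹ * (32 * d) ^ 2) ^ n := by gcongr
      _ ≤ (2⁻¹ * (32 * d) ^ 2) ^ n * (4⁻¹ * (32 * d) ^ 2) :=
          le_mul_of_one_le_right (by positivity) (by nlinarith)
      _ = _ := by rw [mul_pow, ← pow_mul (32 * (d : ℝ)) 2 n]; ring
  have h := ENNReal.ofReal_le_ofReal hreal
  rw [ENNReal.ofReal_mul (by positivity), ENNReal.ofReal_mul (by positivity),
    ENNReal.ofReal_mul (by positivity), ENNReal.ofReal_pow (by positivity) 2,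
    ENNReal.ofReal_pow (by positivity) (n + 1), ENNReal.ofReal_pow (by positivity) n,
    ENNReal.ofReal_pow (by positivity) n, ENNReal.ofReal_natCast,
    ENNReal.ofReal_inv_of_pos (by norm_num), ENNReal.ofReal_inv_of_pos (by norm_num),
    ENNReal.ofReal_ofNat, ENNReal.ofReal_ofNat] at h
  convert h using 4
  rw [ENNReal.ofReal_mul (by norm_num)]
  simp

/-- The total mass of the bad cubes is at most half of the mass of the function. -/
lemma tsum_bad_le {d : ℕ} (hd : 1 ≤ d) {M : ℕ → ℝ≥0∞} (hM0 : ∀ n, M n ≠ 0)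
    (hMT : ∀ n, M n ≠ ⊤) {C : ℝ≥0} (hC : 0 < C) {T : ℝ≥0∞}
    {D : ∀ n, (Fin n → Fin d) → EuclideanSpace ℝ (Fin d) → ℝ≥0∞}
    (hD : ∀ n i, ∫⁻ x, D n i x ≤
      ENNReal.ofReal ((2 * Real.pi) ^ (2 * n)) * (M n ^ 2 * (C ^ 2 * T))) :
    ∑' (k : Fin d → ℤ) (n : ℕ) (i : Fin n → Fin d),
      (∫⁻ x in cube (WithLp.toLp 2 fun i => (k i : ℝ)) 1, D n i x) /
        (((32 * d : ℝ≥0) : ℝ≥0∞) ^ (n + 1) * M n * C) ^ 2 ≤ T / 2 := by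
  have hC0 : (C : ℝ≥0∞) ≠ 0 := by exact_mod_cast hC.ne'
  have hB0 : ((32 * d : ℝ≥0) : ℝ≥0∞) ≠ 0 := by
    have : (32 * d : ℝ≥0) ≠ 0 := mul_ne_zero (by norm_num) (by positivity)
    exact_mod_cast this
  have hterm : ∀ n i, (∫⁻ x, D n i x) / (((32 * d : ℝ≥0) : ℝ≥0∞) ^ (n + 1) * M n * C) ^ 2 ≤
      ENNReal.ofReal ((2 * Real.pi) ^ (2 * n)) * T / (((32 * d : ℝ≥0) : ℝ≥0∞) ^ (n + 1)) ^ 2 := by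
    intro n i
    have hMC0 : (M n * C) ^ 2 ≠ 0 := pow_ne_zero _ (mul_ne_zero (hM0 n) hC0)
    have hMCT : (M n * C) ^ 2 ≠ ⊤ :=
      (ENNReal.pow_lt_top (ENNReal.mul_lt_top (hMT n).lt_top ENNReal.coe_lt_top)).ne
    rw [mul_assoc _ (M n), mul_pow _ (M n * C)]
    rw [← ENNReal.mul_div_mul_right (ENNReal.ofReal ((2 * Real.pi) ^ (2 * n)) * T) _ hMC0 hMCT]
    gcongr
    exact (hD n i).trans (le_of_eq (by ring))
  have hn : ∀ n : ℕ, ∑' i : Fin n → Fin d,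
      (∫⁻ x, D n i x) / (((32 * d : ℝ≥0) : ℝ≥0∞) ^ (n + 1) * M n * C) ^ 2 ≤
        4⁻¹ * 2⁻¹ ^ n * T := by
    intro n
    have hBn0 : (((32 * d : ℝ≥0) : ℝ≥0∞) ^ (n + 1)) ^ 2 ≠ 0 := pow_ne_zero _ (pow_ne_zero _ hB0)
    have hBnT : (((32 * d : ℝ≥0) : ℝ≥0∞) ^ (n + 1)) ^ 2 ≠ ⊤ :=
      (ENNReal.pow_lt_top (ENNReal.pow_lt_top ENNReal.coe_lt_top)).ne
    calc _ ≤ ∑' _i : Fin n → Fin d, ENNReal.ofReal ((2 * Real.pi) ^ (2 * n)) * T /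
            (((32 * d : ℝ≥0) : ℝ≥0∞) ^ (n + 1)) ^ 2 := ENNReal.tsum_le_tsum fun i => hterm n i
      _ = ENNReal.ofReal ((2 * Real.pi) ^ (2 * n)) * (d : ℝ≥0∞) ^ n * T /
            (((32 * d : ℝ≥0) : ℝ≥0∞) ^ (n + 1)) ^ 2 := by
          rw [tsum_fintype, Finset.sum_const, Finset.card_univ, Fintype.card_fun, Fintype.card_fin,
            Fintype.card_fin, nsmul_eq_mul, ← mul_div_assoc]
          push_cast
          ring_nf
      _ ≤ 4⁻¹ * 2⁻¹ ^ n * (((32 * d : ℝ≥0) : ℝ≥0∞) ^ (n + 1)) ^ 2 * T /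
            (((32 * d : ℝ≥0) : ℝ≥0∞) ^ (n + 1)) ^ 2 := by
          exact ENNReal.div_le_div_right (mul_le_mul_left (four_mul_pow_le hd n) T) _
      _ = 4⁻¹ * 2⁻¹ ^ n * T := by
          rw [mul_right_comm]
          exact ENNReal.mul_div_cancel_right hBn0 hBnT
  -- With the sum over cubes innermost, the local integrals recombine into the global ones, to which
  -- `hD` applies.
  calc _ = ∑' (n : ℕ) (i : Fin n → Fin d),
      (∫⁻ x, D n i x) / (((32 * d : ℝ≥0) : ℝ≥0∞) ^ (n + 1) * M n * C) ^ 2 := by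
        rw [ENNReal.tsum_comm]
        refine tsum_congr fun n => ?_
        rw [ENNReal.tsum_comm]
        refine tsum_congr fun i => ?_
        simp only [div_eq_mul_inv]
        rw [ENNReal.tsum_mul_right, ← lintegral_eq_tsum_cube]
    _ ≤ ∑' n : ℕ, 4⁻¹ * 2⁻¹ ^ n * T := ENNReal.tsum_le_tsum hn
    _ = T / 2 := by
        rw [ENNReal.tsum_mul_right, ENNReal.tsum_mul_left, ENNReal.tsum_geometric,
          ENNReal.one_sub_inv_two, inv_inv, div_eq_mul_inv, mul_comm T]
        congr 1
        rw [show (4 : ℝ≥0∞) = 2 * 2 by norm_num, ENNReal.mul_inv (by simp) (by simp), mul_assoc,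
          ENNReal.inv_mul_cancel (by simp) (by simp), mul_one]

theorem proposition3p1 (d : ℕ) (hd : 1 ≤ d) :
    ∃ A : ℝ≥0, 1 < A ∧
      ∀ W : ℝ≥0 → ℝ≥0∞, IsWeight W → logIntegral W = ⊤ →
      ∀ C_W : ℝ≥0, 0 < C_W → ∀ γ : ℝ≥0, 0 < γ → γ < 1 →
        remezConst (modifiedSeq (weightSeq W) A d) d
          (1 / (C_W * A ^ (1 + d) * weightSeq W d)) (γ / 2) < ⊤ ∧
        ∀ f : Lp ℂ 2 (volume : Measure (EuclideanSpace ℝ (Fin d))),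
          (∫⁻ ξ, (‖(𝓕 f : Lp ℂ 2 (volume : Measure (EuclideanSpace ℝ (Fin d)))) ξ‖ₑ
              * W ‖ξ‖₊) ^ 2) ≤ C_W ^ 2 * ∫⁻ x, ‖f x‖ₑ ^ 2 →
          ∀ E : Set (EuclideanSpace ℝ (Fin d)), IsRelativelyDense γ 1 E →
            (∫⁻ x, ‖f x‖ₑ ^ 2) ≤
              4 / γ * remezConst (modifiedSeq (weightSeq W) A d) d
                (1 / (C_W * A ^ (1 + d) * weightSeq W d)) (γ / 2) ^ 2 *
                ∫⁻ x in E, ‖f x‖ₑ ^ 2 := by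
  have hd' : (1 : ℝ≥0) ≤ d := by exact_mod_cast hd
  have hB1 : (1 : ℝ≥0) ≤ 32 * d := hd'.trans (le_mul_of_one_le_left zero_le (by norm_num))
  have hA1 : (1 : ℝ≥0) < 2 * (32 * d) := lt_of_lt_of_le (by norm_num) (mul_le_mul_right hB1 2)
  -- A = 2B: the factor 32d pays for the bad cubes, the factor 2 for the Sobolev constant.
  refine ⟨2 * (32 * d), hA1, fun W hW hlog C hC γ hγ _ => ?_⟩
  have hfin := hW.weightSeq_lt_top hlog
  have hM0 : ∀ n, weightSeq W n ≠ 0 := fun n =>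
    (zero_lt_one.trans_le (hW.one_le_weightSeq n)).ne'
  have hΘ : remezConst (modifiedSeq (weightSeq W) (2 * (32 * d)) d) d
      (1 / (C * (2 * (32 * d) : ℝ≥0) ^ (1 + d) * weightSeq W d)) (γ / 2) < ⊤ := by
    refine hW.remezConst_lt_top hlog (zero_lt_one.trans hA1) d ?_ ?_
    · exact ENNReal.div_ne_zero.2 ⟨by exact_mod_cast hγ.ne', by simp⟩
    · exact ENNReal.div_ne_zero.2 ⟨one_ne_zero, ENNReal.mul_ne_top (ENNReal.mul_ne_top
        ENNReal.coe_ne_top (ENNReal.pow_lt_top ENNReal.coe_lt_top).ne) (hfin d).ne⟩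
  refine ⟨hΘ, fun f hf E hE => ?_⟩
  obtain ⟨u, hu, hfu, hder⟩ := hW.exists_contDiff_representative hfin f hf
  have hTf : ∫⁻ x, ‖f x‖ₑ ^ 2 < ⊤ := by
    rw [lintegral_enorm_sq_eq]
    exact ENNReal.pow_lt_top (Lp.memLp f).2
  have hT : ∫⁻ x, ‖f x‖ₑ ^ 2 = ∫⁻ x, ‖u x‖ₑ ^ 2 :=
    lintegral_congr_ae (hfu.mono fun x hx => by simp only [hx])
  have hTE : ∫⁻ x in E, ‖f x‖ₑ ^ 2 = ∫⁻ x in E, ‖u x‖ₑ ^ 2 :=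
    lintegral_congr_ae ((ae_restrict_of_ae hfu).mono fun x hx => by simp only [hx])
  rw [hT] at hTf hder
  rw [hT, hTE]
  set Θ := remezConst (modifiedSeq (weightSeq W) (2 * (32 * d)) d) d
      (1 / (C * (2 * (32 * d) : ℝ≥0) ^ (1 + d) * weightSeq W d)) (γ / 2) with hΘdef
  set T := ∫⁻ x, ‖u x‖ₑ ^ 2 with hTdef
  set Q : (Fin d → ℤ) → Set (EuclideanSpace ℝ (Fin d)) := fun k =>
    cube (WithLp.toLp 2 fun i => (k i : ℝ)) 1 with hQ
  -- A good cube is controlled by the first summand. On a bad cube a single violated inequality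
  -- already bounds the mass by one term of the series, so the series may run over all cubes, orders
  -- and directions.
  have hsplit : ∀ k, ∫⁻ x in Q k, ‖u x‖ₑ ^ 2 ≤ 2 / γ * Θ ^ 2 * (∫⁻ x in E ∩ Q k, ‖u x‖ₑ ^ 2) +
      ∑' (n : ℕ) (i : Fin n → Fin d), (∫⁻ x in Q k,
        ‖iteratedFDeriv ℝ n u x fun k => EuclideanSpace.single (i k) (1 : ℝ)‖ₑ ^ 2) /
        (((32 * d : ℝ≥0) : ℝ≥0∞) ^ (n + 1) * weightSeq W n * C) ^ 2 := by
    intro k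
    by_cases hgood : ∀ (n : ℕ) (i : Fin n → Fin d), ∫⁻ x in Q k,
        ‖iteratedFDeriv ℝ n u x fun k => EuclideanSpace.single (i k) (1 : ℝ)‖ₑ ^ 2 ≤
        (((32 * d : ℝ≥0) : ℝ≥0∞) ^ (n + 1) * weightSeq W n * C) ^ 2 * ∫⁻ x in Q k, ‖u x‖ₑ ^ 2
    · exact (lintegral_cube_le_remezConst hW.weightSeq_mono (hM0 d) (hfin d).ne hB1 hC hγ hΘ hu _
        hgood hE.1 (hE.2 _)).trans le_self_add
    · push Not at hgood
      obtain ⟨n, i, hlt⟩ := hgood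
      refine le_trans ?_ le_add_self
      refine le_trans ?_ (ENNReal.le_tsum n)
      refine le_trans ?_ (ENNReal.le_tsum i)
      rw [ENNReal.le_div_iff_mul_le, mul_comm]
      · exact hlt.le
      · left
        have hB0 : (32 * d : ℝ≥0) ≠ 0 := (zero_lt_one.trans_le hB1).ne'
        exact pow_ne_zero _ (mul_ne_zero (mul_ne_zero (pow_ne_zero _ (by exact_mod_cast hB0))
          (hM0 n)) (by exact_mod_cast hC.ne'))
      · left
        exact (ENNReal.pow_lt_top (ENNReal.mul_lt_top (ENNReal.mul_lt_top
          (ENNReal.pow_lt_top ENNReal.coe_lt_top) (hfin n)) ENNReal.coe_lt_top)).ne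
  have hEsum : ∑' k, ∫⁻ x in E ∩ Q k, ‖u x‖ₑ ^ 2 = ∫⁻ x in E, ‖u x‖ₑ ^ 2 := by
    rw [← lintegral_indicator hE.1, lintegral_eq_tsum_cube]
    refine tsum_congr fun k => ?_
    rw [lintegral_indicator hE.1, Measure.restrict_restrict hE.1]
  have hbad := tsum_bad_le hd hM0 (fun n => (hfin n).ne) hC hder
  have hmain : T ≤ 2 / γ * Θ ^ 2 * (∫⁻ x in E, ‖u x‖ₑ ^ 2) + T / 2 := by
    calc T = ∑' k, ∫⁻ x in Q k, ‖u x‖ₑ ^ 2 := lintegral_eq_tsum_cube _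
      _ ≤ _ := ENNReal.tsum_le_tsum hsplit
      _ ≤ _ := by
        rw [ENNReal.tsum_add, ENNReal.tsum_mul_left, hEsum]
        gcongr
  -- Absorbing T/2 into the left side requires T < ∞, which is where f ∈ L² is used.
  have hhalf : T / 2 ≤ 2 / γ * Θ ^ 2 * (∫⁻ x in E, ‖u x‖ₑ ^ 2) := by
    refine (ENNReal.add_le_add_iff_right (ENNReal.div_ne_top hTf.ne two_ne_zero)).1 ?_
    rwa [ENNReal.add_halves]
  calc T = 2 * (T / 2) := (ENNReal.mul_div_cancel two_ne_zero (by simp)).symm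
    _ ≤ 2 * (2 / γ * Θ ^ 2 * (∫⁻ x in E, ‖u x‖ₑ ^ 2)) := by gcongr
    _ = _ := by
      rw [← mul_assoc, ← mul_assoc, ← mul_div_assoc]
      norm_num
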